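/- **Setting.** Let $k\ge1$, $p\ge 0$, and let $c\in\mathbb R^p$, $f_0,\dots,f_k:\mathbb R^p\to\mathbb R^p$ parametrise the nonlinear VAR($k$) $f_0(z_t)=c+\sum_{i=1}^k f_i(z_{t-i})+u_t$. Put $\pi(z)=-f_0(z)+\sum_{i=1}^k f_i(z)$, $g_j(z)=-\sum_{i=j+1}^k f_i(z)$ and $\boldsymbol g=(g_1,\dots,g_{k-1})$ (stacked). Let $D\in\mathbb R^{p(k-1)\times p(k-1)}$ be the block matrix with $-I_p$ on the diagonal, $I_p$ on the first superdiagonal and zeros elsewhere, $E=[I_p;0]\in\mathbb R^{p(k-1)\times p}$ (blocks stacked vertically), $\boldsymbol D_0=\begin{bmatrix}0_{r\times p}&0\\0&D\end{bmatrix}$ and, for $\alpha\in\mathbb R^{p\times r}$, $\boldsymbol\alpha=\begin{bmatrix}\alpha&E^{T}\\0&I_{p(k-1)}\end{bmatrix}$ (when $k=1$ all blocks of size $p(k-1)$ are empty). For a bounded set $\mathcal A$ of square real matrices let $\rho_{\mathrm{JSR}}(\mathcal A)=\limsup_{t\to\infty}\sup_{M\in\mathcal A^t}\rho(M)^{1/t}$,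 where $\mathcal A^t$ is the set of $t$-fold products of elements of $\mathcal A$ and $\rho$ is the spectral radius. Matrix norms are the operator norms induced by the Euclidean norms. **The class.** Let $\operatorname{rank}\alpha=r$, $\bar b\in\mathbb R$, $\bar\rho\in[0,1)$. The model $(c,\{f_i\}_{i=0}^k)$ belongs to $\mathcal M_r(\alpha,\bar b,\bar\rho)$ *with gradient set* $\mathcal B$ if: (i) $f_0$ is a homeomorphism of $\mathbb R^p$; (ii) there are $\mu\in\mathbb R^r$ and $\theta:\mathbb R^p\to\mathbb R^r$ with $c=\alpha\mu$ and $\pi(z)=\alpha\theta(z)$ for all $z$; (iii) $\mathcal B\subset\mathbb R^{pk\times[p(k-1)+r]}$ is closed, $\|\boldsymbol\beta\|\le\bar b$ for all $\boldsymbol\beta\in\mathcal B$, $\rho_{\mathrm{JSR}}(\{I+\boldsymbol\beta^{T}\boldsymbol\alpha:\boldsymbol\beta\in\mathcal B\})\le\bar\rho$, and, with $\boldsymbol\theta=(\theta,\boldsymbol g)$, for all $\boldsymbol z=(z,\zeta)$ and $\boldsymbol z'=(z',\zeta')$ in $\mathbb R^p\times\mathbb R^{p(k-1)}$ there is $\boldsymbol\beta\in\mathcal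 B$ with $$[\boldsymbol\theta(f_0^{-1}(z))+\boldsymbol D_0\boldsymbol z]-[\boldsymbol\theta(f_0^{-1}(z'))+\boldsymbol D_0\boldsymbol z']=\boldsymbol\beta^{T}(\boldsymbol z-\boldsymbol z').$$ It belongs to $\mathcal M_r(\alpha,\bar b,\bar\rho)$ if it does so with some gradient set. **Piecewise affine VARs.** The model is piecewise affine if each $f_i$ is continuous and $f_i(z)=\sum_{\ell=1}^L\mathbf 1\{z\in Z^{(\ell)}\}(\bar\phi_i^{(\ell)}+\Phi_i^{(\ell)}z)$, where the convex sets $Z^{(1)},\dots,Z^{(L)}$ partition $\mathbb R^p$. It is *piecewise linear* if moreover all $\bar\phi_i^{(\ell)}=0$ and, for some basis $a_1,\dots,a_p$ of $\mathbb R^p$, each $Z^{(\ell)}$ is a union of cones $\{z: a_i^{T}z\ge0\ \forall i\in I,\ a_i^{T}z<0\ \forall i\notin I\}$, $I\subset\{1,\dots,p\}$. It is *threshold affine* if moreover $Z^{(\ell)}=\{z:a^{T}z\in(\tau_{\ell-1},\tau_\ell]\}$ for some $a\ne0$ and $-\infty=\tau_0<\tau_1<\dots<\tau_L=+\infty$.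 Put $\bar\pi^{(\ell)}=-(\bar\phi_0^{(\ell)}-\sum_{i=1}^k\bar\phi_i^{(\ell)})$, $\Pi^{(\ell)}=-(\Phi_0^{(\ell)}-\sum_{i=1}^k\Phi_i^{(\ell)})$ and $\boldsymbol\Gamma^{(\ell)}=[-\sum_{i=j+1}^k\Phi_i^{(\ell)}]_{j=1}^{k-1}$ (stacked vertically). **Proposition.** Let $(c,\{f_i\}_{i=0}^k)$ be a piecewise linear or threshold affine VAR, $\alpha\in\mathbb R^{p\times r}$ with $\operatorname{rank}\alpha=r$, and $\bar\rho\in[0,1)$, such that * PWA.1: $\operatorname{sgn}\det\Phi_0^{(\ell)}=\operatorname{sgn}\det\Phi_0^{(1)}\neq0$ for all $\ell$; * PWA.2: $c=\alpha\mu$, $\bar\pi^{(\ell)}=\alpha\bar\mu^{(\ell)}$ and $\Pi^{(\ell)}=\alpha\beta^{(\ell)T}$ for all $\ell$, with $\mu,\bar\mu^{(\ell)}\in\mathbb R^r$ and $\beta^{(\ell)}\in\mathbb R^{p\times r}$ of rank $r$; * PWA.3: $\rho_{\mathrm{JSR}}(\{I+\boldsymbol\beta^{(\ell)T}\boldsymbol\alpha\}_{\ell=1}^L)\le\bar\rho$,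 where $\boldsymbol\beta^{(\ell)T}=\begin{bmatrix}\beta^{(\ell)T}(\Phi_0^{(\ell)})^{-1}&0\\ \boldsymbol\Gamma^{(\ell)}(\Phi_0^{(\ell)})^{-1}&D\end{bmatrix}$. Suppose that $\Phi_0^{(\ell)}=\Phi_0$ for all $\ell$, with $\Phi_0$ nonsingular. Let $K:\mathbb R^p\to\mathbb R$ be continuous and nonnegative with $\int K(u)\,du=1$, $\int\|u\|K(u)\,du<\infty$ and $\int uK(u)\,du=0$. Then for every $i$ and $z$ the integral $f_{i,K}(z)=\int_{\mathbb R^p}f_i(z+u)K(u)\,du$ converges absolutely, and for every $\bar b\ge\max_\ell\|\boldsymbol\beta^{(\ell)}\|$ the model $(c,\{f_{i,K}\}_{i=0}^k)$ belongs to $\mathcal M_r(\alpha,\bar b,\bar\rho)$. More precisely, both $(c,\{f_i\})$ and $(c,\{f_{i,K}\})$ belong to $\mathcal M_r(\alpha,\bar b,\bar\rho)$ with the same gradient set $\mathcal B$, the convex hull of $\boldsymbol\beta^{(1)},\dots,\boldsymbol\beta^{(L)}$. -/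

import Mathlib

open scoped Matrix Pointwise ENNReal

noncomputable section

namespace NVAR

/-- The operator norm of a real matrix induced by the Euclidean norms. -/
def opNorm {m n : Type*} [Fintype m] [Fintype n] [DecidableEq n] (M : Matrix m n ℝ) : ℝ :=
  ‖LinearMap.toContinuousLinearMap (Matrix.toEuclideanLin M)‖

/-- The joint spectral radius `limsup_t sup_{B ∈ 𝒜 ^ t} ρ(B) ^ (1 / t)`, where `𝒜 ^ t` is the set of
`t`-fold products of members of `𝒜` and `ρ(B)` is the largest modulus of a complex eigenvalue. -/
def jsr {n : Type*} [Fintype n] [DecidableEq n] (𝒜 : Set (Matrix n n ℝ)) : ℝ≥0∞ :=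
  Filter.limsup
    (fun t : ℕ => ⨆ B ∈ 𝒜 ^ t, spectralRadius ℂ (B.map Complex.ofReal) ^ (1 / (t : ℝ)))
    Filter.atTop

variable {k p r L : ℕ}

/-- Row index of the stacked state `(z, ζ)` in `ℝᵖ × ℝ^{p(k-1)}`; the pair `(j, a)` stands for
coordinate `a` of the block `j + 1`. -/
abbrev StateIdx (k p : ℕ) : Type := Fin p ⊕ (Fin (k - 1) × Fin p)

/-- Index set of size `r + p(k-1)`. -/
abbrev EqIdx (k p r : ℕ) : Type := Fin r ⊕ (Fin (k - 1) × Fin p)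

/-- `π(z) = -f₀(z) + ∑_{i=1}^k fᵢ(z)`. -/
def piMap (f : Fin (k + 1) → (Fin p → ℝ) → (Fin p → ℝ)) (z : Fin p → ℝ) : Fin p → ℝ :=
  -f 0 z + ∑ i : Fin k, f i.succ z

/-- `g_j(z) = -∑_{i=j+1}^k fᵢ(z)`. -/
def gMap (f : Fin (k + 1) → (Fin p → ℝ) → (Fin p → ℝ)) (j : ℕ) (z : Fin p → ℝ) : Fin p → ℝ :=
  -∑ i : Fin (k + 1) with j < i.val, f i z

/-- `𝛉(z) = (θ(z), g₁(z), …, g_{k-1}(z))`. -/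
def boldTheta (f : Fin (k + 1) → (Fin p → ℝ) → (Fin p → ℝ)) (θ : (Fin p → ℝ) → (Fin r → ℝ))
    (z : Fin p → ℝ) : EqIdx k p r → ℝ :=
  Sum.elim (θ z) (fun q => gMap f (q.1.val + 1) z q.2)

/-- The block bidiagonal matrix with `-I_p` on the diagonal and `I_p` on the superdiagonal. -/
def matD (k p : ℕ) : Matrix (Fin (k - 1) × Fin p) (Fin (k - 1) × Fin p) ℝ :=
  Matrix.of fun x y =>
    if x.2 = y.2 then
      (if x.1 = y.1 then -1 else if y.1.val = x.1.val + 1 then 1 else 0)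
    else 0

/-- `𝐃₀ = [0, 0; 0, D]`. -/
def boldD0 (k p r : ℕ) : Matrix (EqIdx k p r) (StateIdx k p) ℝ :=
  Matrix.fromBlocks 0 0 0 (matD k p)

/-- `E = (I_p, 0)ᵀ`: the identity in the first block, zero in the others. -/
def matE (k p : ℕ) : Matrix (Fin (k - 1) × Fin p) (Fin p) ℝ :=
  Matrix.of fun x b => if x.1.val = 0 ∧ x.2 = b then 1 else 0

/-- `𝛂 = [α, Eᵀ; 0, I]`. -/
def boldAlpha (k : ℕ) (α : Matrix (Fin p) (Fin r) ℝ) : Matrix (StateIdx k p) (EqIdx k p r) ℝ :=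
  Matrix.fromBlocks α (matE k p)ᵀ 0 1

/-- The model `f₀(z_t) = c + ∑_{i=1}^k fᵢ(z_{t-i}) + u_t` belongs to the class
`𝓜_r(α, bbar, ρbar)`, and `B` is a set of gradients that witnesses the membership. -/
def MemClassWith (α : Matrix (Fin p) (Fin r) ℝ) (bbar ρbar : ℝ) (c : Fin p → ℝ)
    (f : Fin (k + 1) → (Fin p → ℝ) → (Fin p → ℝ))
    (B : Set (Matrix (StateIdx k p) (EqIdx k p r) ℝ)) : Prop :=
  ∃ (F₀ : (Fin p → ℝ) ≃ₜ (Fin p → ℝ)) (μ : Fin r → ℝ) (θ : (Fin p → ℝ) → (Fin r → ℝ)),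
    (∀ z, F₀ z = f 0 z) ∧
    c = α *ᵥ μ ∧
    (∀ z, piMap f z = α *ᵥ θ z) ∧
    IsClosed B ∧
    (∀ β ∈ B, opNorm β ≤ bbar) ∧
    jsr {M | ∃ β ∈ B, M = 1 + βᵀ * boldAlpha k α} ≤ ENNReal.ofReal ρbar ∧
    ∀ (z z' : Fin p → ℝ) (ζ ζ' : Fin (k - 1) × Fin p → ℝ), ∃ β ∈ B,
      (boldTheta f θ (F₀.symm z) + boldD0 k p r *ᵥ Sum.elim z ζ)
          - (boldTheta f θ (F₀.symm z') + boldD0 k p r *ᵥ Sum.elim z' ζ')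
        = βᵀ *ᵥ (Sum.elim z ζ - Sum.elim z' ζ')

/-- Membership in the class `𝓜_r(α, bbar, ρbar)`. -/
def MemClass (α : Matrix (Fin p) (Fin r) ℝ) (bbar ρbar : ℝ) (c : Fin p → ℝ)
    (f : Fin (k + 1) → (Fin p → ℝ) → (Fin p → ℝ)) : Prop :=
  ∃ B, MemClassWith α bbar ρbar c f B

/-- `fᵢ(z) = ∑_ℓ 1{z ∈ Z ℓ} (φ i ℓ + Φ i ℓ z)`, with convex sets `Z ℓ` that partition `ℝᵖ`, and each
`fᵢ` is continuous. -/
structure IsPiecewiseAffineVAR (Z : Fin L → Set (Fin p → ℝ))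
    (φ : Fin (k + 1) → Fin L → (Fin p → ℝ)) (Φ : Fin (k + 1) → Fin L → Matrix (Fin p) (Fin p) ℝ)
    (f : Fin (k + 1) → (Fin p → ℝ) → (Fin p → ℝ)) : Prop where
  convex : ∀ ℓ, Convex ℝ (Z ℓ)
  disjoint : Pairwise fun ℓ ℓ' => Disjoint (Z ℓ) (Z ℓ')
  cover : ⋃ ℓ, Z ℓ = Set.univ
  eq : ∀ i z, f i z = ∑ ℓ, (Z ℓ).indicator (fun w => φ i ℓ + Φ i ℓ *ᵥ w) z
  continuous : ∀ i, Continuous (f i)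

/-- The cone `{z | aᵢᵀ z ≥ 0 for i ∈ I and aᵢᵀ z < 0 for i ∉ I}`. -/
def cone (a : Fin p → (Fin p → ℝ)) (I : Set (Fin p)) : Set (Fin p → ℝ) :=
  {z | (∀ i ∈ I, 0 ≤ a i ⬝ᵥ z) ∧ ∀ i ∉ I, a i ⬝ᵥ z < 0}

/-- A piecewise linear VAR. -/
structure IsPiecewiseLinearVAR (Z : Fin L → Set (Fin p → ℝ))
    (φ : Fin (k + 1) → Fin L → (Fin p → ℝ)) (Φ : Fin (k + 1) → Fin L → Matrix (Fin p) (Fin p) ℝ)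
    (f : Fin (k + 1) → (Fin p → ℝ) → (Fin p → ℝ)) : Prop
    extends IsPiecewiseAffineVAR Z φ Φ f where
  cones : ∃ a : Module.Basis (Fin p) ℝ (Fin p → ℝ), ∀ ℓ, ∃ 𝓘 : Set (Set (Fin p)),
    Z ℓ = ⋃ I ∈ 𝓘, cone a I
  intercept : ∀ i ℓ, φ i ℓ = 0

/-- A threshold affine VAR: the cells are the bands `{z | aᵀ z ∈ (τ_{ℓ-1}, τ_ℓ]}`, with
`-∞ = τ₀ < τ₁ < ⋯ < τ_L = +∞`. -/
structure IsThresholdAffineVAR (Z : Fin L → Set (Fin p → ℝ))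
    (φ : Fin (k + 1) → Fin L → (Fin p → ℝ)) (Φ : Fin (k + 1) → Fin L → Matrix (Fin p) (Fin p) ℝ)
    (f : Fin (k + 1) → (Fin p → ℝ) → (Fin p → ℝ)) : Prop
    extends IsPiecewiseAffineVAR Z φ Φ f where
  bands : ∃ (a : Fin p → ℝ) (τ : Fin (L + 1) → EReal), a ≠ 0 ∧ StrictMono τ ∧
    τ 0 = ⊥ ∧ τ (Fin.last L) = ⊤ ∧
    ∀ ℓ, Z ℓ = {z | ((a ⬝ᵥ z : ℝ) : EReal) ∈ Set.Ioc (τ ℓ.castSucc) (τ ℓ.succ)}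

/-- The stacked matrix with blocks `Γ_j = -∑_{i=j+1}^k Φᵢ` for `j = 1, …, k - 1`. -/
def boldGamma (Φ : Fin (k + 1) → Matrix (Fin p) (Fin p) ℝ) :
    Matrix (Fin (k - 1) × Fin p) (Fin p) ℝ :=
  Matrix.of fun x b => (-∑ i : Fin (k + 1) with x.1.val + 1 < i.val, Φ i) x.2 b

/-- `𝛃`, given through `𝛃ᵀ = [βᵀ Φ₀⁻¹, 0; 𝚪 Φ₀⁻¹, D]`. -/
def boldBeta (Φ : Fin (k + 1) → Matrix (Fin p) (Fin p) ℝ) (β : Matrix (Fin p) (Fin r) ℝ) :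
    Matrix (StateIdx k p) (EqIdx k p r) ℝ :=
  (Matrix.fromBlocks (βᵀ * (Φ 0)⁻¹) 0 (boldGamma Φ * (Φ 0)⁻¹) (matD k p))ᵀ

/-- `g_K(z) = ∫ g(z + u) K(u) du`. -/
def smoothed (K : (Fin p → ℝ) → ℝ) (g : (Fin p → ℝ) → (Fin p → ℝ)) (z : Fin p → ℝ) : Fin p → ℝ :=
  ∫ u, K u • g (z + u)

end NVAR

end

/-! Membership in the class rests on two properties of the functions of a model. Their increments
are convex combinations of the increments of the linear maps `Φ i ℓ`, with weights common to all `i`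
(`HasConvexIncrements`), and `piMap` takes its values in the column space of `α`. The original model
has the first property because, along a segment, the stacked `f i` form a continuous piecewise
affine curve, whose increment is the average of its slopes
(`sub_mem_convexHull_of_piecewise_affine`). Smoothing keeps both properties: it averages increments
between `w + u` and `w' + u`, whose difference does not depend on `u`. As the leading matrix is
common, the zeroth function is affine with linear part `Φ₀`, and the weights pass unchanged to the
matrices `boldBeta` (`memClassWith_of_hasConvexIncrements`).

It remains to see that the convex hull of the gradients has no larger joint spectral radius.
Spectral radii are not convex but norms are, so the bound is first transferred from spectral radii
to norms of products; this is the Berger-Wang inequality `exists_totalGrowth_le`. Norm bounds then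
pass to the hull one factor at a time (`norm_mulVec_convexHull_pow_le`).

Berger-Wang is proved by contradiction. After rescaling to critical growth there is a seminorm that
no matrix expands and that some matrix preserves at each vector (`exists_extremal_seminorm`). An
orbit on its unit sphere nearly returns to itself, so some product nearly fixes a unit vector.
Cayley-Hamilton forbids this when the spectral radii of the products stay below some `q < 1`
(`exists_gap`). -/

noncomputable section

namespace NVAR

set_option linter.unusedSectionVars false

/-! ### Berger-Wang inequality: growth of products and extremal seminorms. -/

section BergerWang

open Filter Topology

variable {ι n : Type*} [Fintype ι] [Fintype n] [DecidableEq n]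

/-- The seminorm `x ↦ max ‖M x‖`, over the products `M` of `t` members of the family `A`. -/
def growth (A : ι → Matrix n n ℝ) : ℕ → Seminorm ℝ (n → ℝ)
  | 0 => normSeminorm ℝ (n → ℝ)
  | t + 1 => Finset.univ.sup fun i => (growth A t).comp (A i).mulVecLin

/-- A bound for the operator norm of `t`-fold products of members of `A`. -/
def totalGrowth (A : ι → Matrix n n ℝ) (t : ℕ) : ℝ := ∑ j, growth A t (Pi.single j 1)

lemma growth_zero (A : ι → Matrix n n ℝ) (x : n → ℝ) : growth A 0 x = ‖x‖ := rfl

lemma growth_mulVec_le (A : ι → Matrix n n ℝ) (t : ℕ) (i : ι) (x : n → ℝ) :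
    growth A t (A i *ᵥ x) ≤ growth A (t + 1) x :=
  Seminorm.le_finset_sup_apply (p := fun i => (growth A t).comp (A i).mulVecLin)
    (Finset.mem_univ i)

lemma exists_growth_succ [Nonempty ι] (A : ι → Matrix n n ℝ) (t : ℕ) (x : n → ℝ) :
    ∃ i, growth A (t + 1) x = growth A t (A i *ᵥ x) := by
  obtain ⟨i, -, hi⟩ := Seminorm.exists_apply_eq_finset_sup
    (fun i => (growth A t).comp (A i).mulVecLin) Finset.univ_nonempty x
  exact ⟨i, hi⟩

lemma seminorm_le_norm_mul_sum (N : Seminorm ℝ (n → ℝ)) (x : n → ℝ) :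
    N x ≤ ‖x‖ * ∑ j, N (Pi.single j 1) := by
  have hx : x = ∑ j, x j • (Pi.single j (1 : ℝ) : n → ℝ) := by
    ext k
    simp [Finset.sum_apply, Pi.single_apply]
  calc N x = N (∑ j, x j • (Pi.single j (1 : ℝ) : n → ℝ)) := by rw [← hx]
    _ ≤ ∑ j, N (x j • (Pi.single j (1 : ℝ) : n → ℝ)) := Finset.le_sum_of_subadditive N (map_zero N).le (map_add_le_add N) _ _
    _ ≤ ∑ j, ‖x‖ * N (Pi.single j 1) := by
        refine Finset.sum_le_sum fun j _ => ?_
        rw [map_smul_eq_mul]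
        exact mul_le_mul_of_nonneg_right (norm_le_pi_norm x j) (apply_nonneg N _)
    _ = _ := by rw [Finset.mul_sum]

lemma growth_le (A : ι → Matrix n n ℝ) (t : ℕ) (x : n → ℝ) :
    growth A t x ≤ ‖x‖ * totalGrowth A t := seminorm_le_norm_mul_sum _ _

lemma totalGrowth_nonneg (A : ι → Matrix n n ℝ) (t : ℕ) : 0 ≤ totalGrowth A t :=
  Finset.sum_nonneg fun _ _ => apply_nonneg _ _

lemma growth_smul [Nonempty ι] (A : ι → Matrix n n ℝ) {s : ℝ} (hs : 0 ≤ s) (t : ℕ) (x : n → ℝ) :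
    growth (fun i => s • A i) t x = s ^ t * growth A t x := by
  induction t generalizing x with
  | zero => simp [growth_zero]
  | succ t ih =>
    have key : ∀ i, growth (fun i => s • A i) t ((s • A i) *ᵥ x)
        = s ^ (t + 1) * growth A t (A i *ᵥ x) := fun i => by
      rw [ih, Matrix.smul_mulVec, map_smul_eq_mul, Real.norm_of_nonneg hs]; ring
    apply le_antisymm
    · obtain ⟨i, hi⟩ := exists_growth_succ (fun i => s • A i) t x
      rw [hi, key]
      exact mul_le_mul_of_nonneg_left (growth_mulVec_le A t i x) (by positivity)
    · obtain ⟨i, hi⟩ := exists_growth_succ A t x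
      rw [hi, ← key]
      exact growth_mulVec_le (fun i => s • A i) t i x

lemma totalGrowth_smul [Nonempty ι] (A : ι → Matrix n n ℝ) {s : ℝ} (hs : 0 ≤ s) (t : ℕ) :
    totalGrowth (fun i => s • A i) t = s ^ t * totalGrowth A t := by
  simp only [totalGrowth, growth_smul A hs, Finset.mul_sum]

lemma growth_add_le [Nonempty ι] (A : ι → Matrix n n ℝ) (T t : ℕ) (x : n → ℝ) :
    growth A (T + t) x ≤ totalGrowth A T * growth A t x := by
  induction t generalizing x with
  | zero => rw [growth_zero, mul_comm]; exact growth_le A T x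
  | succ t ih =>
    obtain ⟨i, hi⟩ := exists_growth_succ A (T + t) x
    rw [← add_assoc, hi]
    exact (ih _).trans
      (mul_le_mul_of_nonneg_left (growth_mulVec_le A t i x) (totalGrowth_nonneg A T))

lemma totalGrowth_add_le [Nonempty ι] (A : ι → Matrix n n ℝ) (T t : ℕ) :
    totalGrowth A (T + t) ≤ totalGrowth A T * totalGrowth A t := by
  rw [totalGrowth, totalGrowth.eq_def A t, Finset.mul_sum]
  exact Finset.sum_le_sum fun j _ => growth_add_le A T t _

lemma norm_mulVec_le_growth (A : ι → Matrix n n ℝ) (t : ℕ) {M : Matrix n n ℝ}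
    (hM : M ∈ (Set.range A) ^ t) (x : n → ℝ) : ‖M *ᵥ x‖ ≤ growth A t x := by
  induction t generalizing x M with
  | zero =>
    rw [pow_zero, Set.mem_one] at hM
    simp [hM, growth_zero]
  | succ t ih =>
    rw [pow_succ] at hM
    obtain ⟨M', hM', _, ⟨i, rfl⟩, rfl⟩ := hM
    rw [← Matrix.mulVec_mulVec]
    exact (ih hM' _).trans (growth_mulVec_le A t i x)

/-- The weighted orbit supremum `sup_t (t + 1) r ^ t max ‖M x‖`. -/
def weightedGrowth (A : ι → Matrix n n ℝ) (r : ℝ) (x : n → ℝ) : ℝ :=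
  ⨆ t : ℕ, ((t : ℝ) + 1) * r ^ t * growth A t x

/-- With `s = √r`, write `r ^ t = s ^ t * s ^ t`: one factor absorbs the weight `t + 1`, the other
the growth of the products. -/
lemma bddAbove_weightedGrowth {A : ι → Matrix n n ℝ}
    (hb : ∀ r : ℝ, 0 < r → r < 1 → ∃ C, ∀ t, r ^ t * totalGrowth A t ≤ C) {r : ℝ} (hr0 : 0 < r)
    (hr1 : r < 1) (x : n → ℝ) :
    BddAbove (Set.range fun t : ℕ => ((t : ℝ) + 1) * r ^ t * growth A t x) := by
  set s := Real.sqrt r with hs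
  have hs0 : 0 < s := Real.sqrt_pos.2 hr0
  have hs1 : s < 1 := by rw [hs, Real.sqrt_lt' one_pos]; simpa using hr1
  have hss : s * s = r := Real.mul_self_sqrt hr0.le
  obtain ⟨C, hC⟩ := hb s hs0 hs1
  have h1 : Tendsto (fun t : ℕ => ((t : ℝ) + 1) * s ^ t) atTop (𝓝 (0 + 0)) := by
    have h := (tendsto_self_mul_const_pow_of_lt_one hs0.le hs1).add
      (tendsto_pow_atTop_nhds_zero_of_lt_one hs0.le hs1)
    refine h.congr fun t => by ring
  obtain ⟨D, hD⟩ := h1.bddAbove_range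
  refine ⟨D * (‖x‖ * C), ?_⟩
  rintro _ ⟨t, rfl⟩
  have hDt : ((t : ℝ) + 1) * s ^ t ≤ D := hD ⟨t, rfl⟩
  calc ((t : ℝ) + 1) * r ^ t * growth A t x
      = (((t : ℝ) + 1) * s ^ t) * (s ^ t * growth A t x) := by rw [← hss, mul_pow]; ring
    _ ≤ D * (‖x‖ * C) := by
        have h2 : s ^ t * growth A t x ≤ ‖x‖ * C := by
          calc s ^ t * growth A t x ≤ s ^ t * (‖x‖ * totalGrowth A t) :=
                mul_le_mul_of_nonneg_left (growth_le A t x) (by positivity)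
            _ = ‖x‖ * (s ^ t * totalGrowth A t) := by ring
            _ ≤ ‖x‖ * C := mul_le_mul_of_nonneg_left (hC t) (norm_nonneg _)
        have h3 : 0 ≤ s ^ t * growth A t x := mul_nonneg (by positivity) (apply_nonneg _ _)
        have h4 : 0 ≤ ((t : ℝ) + 1) * s ^ t := by positivity
        exact mul_le_mul hDt h2 h3 (h4.trans hDt)

/-- A family that is critical for boundedness of its products has a nonzero extremal seminorm. -/
theorem exists_extremal_seminorm [Nonempty ι] (A : ι → Matrix n n ℝ)
    (h1 : ∀ t, 1 ≤ totalGrowth A t)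
    (hb : ∀ r : ℝ, 0 < r → r < 1 → ∃ C, ∀ t, r ^ t * totalGrowth A t ≤ C) :
    ∃ N : Seminorm ℝ (n → ℝ), (∃ x, N x ≠ 0) ∧ (∀ i x, N (A i *ᵥ x) ≤ N x) ∧
      ∀ x, ∃ i, N x ≤ N (A i *ᵥ x) := by
  -- The seminorm is the limit as `r` increases to `1` of `F r`, normalised by its sum `G r` over
  -- the standard basis.
  set F := weightedGrowth A with hF
  set G : ℝ → ℝ := fun r => ∑ j, F r (Pi.single j 1) with hG
  have hle : ∀ {r : ℝ}, 0 < r → r < 1 → ∀ (t : ℕ) (x : n → ℝ),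
      ((t : ℝ) + 1) * r ^ t * growth A t x ≤ F r x := fun h0 h1' t x =>
    le_ciSup (bddAbove_weightedGrowth hb h0 h1' x) t
  have hF0 : ∀ {r : ℝ}, 0 < r → r < 1 → ∀ x : n → ℝ, 0 ≤ F r x := fun h0 h1' x =>
    le_trans (by simp [growth_zero]) (hle h0 h1' 0 x)
  have hFG : ∀ {r : ℝ}, 0 < r → r < 1 → ∀ x : n → ℝ, F r x ≤ ‖x‖ * G r := by
    intro r h0 h1' x
    refine ciSup_le fun t => ?_
    calc ((t : ℝ) + 1) * r ^ t * growth A t x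
        ≤ ((t : ℝ) + 1) * r ^ t * (‖x‖ * totalGrowth A t) :=
          mul_le_mul_of_nonneg_left (growth_le A t x) (by positivity)
      _ = ‖x‖ * ∑ j, ((t : ℝ) + 1) * r ^ t * growth A t (Pi.single j 1) := by
          rw [← Finset.mul_sum, totalGrowth]; ring
      _ ≤ ‖x‖ * G r := mul_le_mul_of_nonneg_left
          (Finset.sum_le_sum fun j _ => hle h0 h1' t _) (norm_nonneg _)
  have hGge : ∀ {r : ℝ}, 0 < r → r < 1 → ∀ t : ℕ, ((t : ℝ) + 1) * r ^ t ≤ G r := by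
    intro r h0 h1' t
    calc ((t : ℝ) + 1) * r ^ t ≤ ((t : ℝ) + 1) * r ^ t * totalGrowth A t :=
          le_mul_of_one_le_right (by positivity) (h1 t)
      _ = ∑ j, ((t : ℝ) + 1) * r ^ t * growth A t (Pi.single j 1) := by
          rw [← Finset.mul_sum, totalGrowth]
      _ ≤ G r := Finset.sum_le_sum fun j _ => hle h0 h1' t _
  have hG1 : ∀ {r : ℝ}, 0 < r → r < 1 → 1 ≤ G r := fun h0 h1' => by
    simpa using hGge h0 h1' 0
  -- Along an ultrafilter the bounded ratios `F r x / G r` converge for all `x` at once.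
  let U : Ultrafilter ℝ := Ultrafilter.of (𝓝[<] (1 : ℝ))
  have hU : (U : Filter ℝ) ≤ 𝓝[<] (1 : ℝ) := Ultrafilter.of_le _
  have hev : ∀ᶠ r in (U : Filter ℝ), 0 < r ∧ r < 1 := by
    apply hU
    have : Set.Ioo (0 : ℝ) 1 ∈ 𝓝[<] (1 : ℝ) := Ioo_mem_nhdsLT one_pos
    exact this
  have hid : Tendsto (fun r : ℝ => r) (U : Filter ℝ) (𝓝 1) :=
    tendsto_id.mono_left (hU.trans nhdsWithin_le_nhds)
  -- The weight `t + 1` makes `G` diverge even when the products stay bounded; hence finitely many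
  -- terms of the supremum do not matter in the limit.
  have hGtop : Tendsto G (U : Filter ℝ) atTop := by
    rw [tendsto_atTop]
    intro b
    obtain ⟨t, ht⟩ := exists_nat_gt b
    have hlim : Tendsto (fun r : ℝ => ((t : ℝ) + 1) * r ^ t) (U : Filter ℝ)
        (𝓝 (((t : ℝ) + 1) * 1 ^ t)) := (hid.pow t).const_mul _
    filter_upwards [hev, hlim.eventually (lt_mem_nhds (show b < ((t : ℝ) + 1) * 1 ^ t by
      simp; linarith))] with r hr hr'
    exact hr'.le.trans (hGge hr.1 hr.2 t)
  have hex : ∀ x, ∃ y, Tendsto (fun r => F r x / G r) (U : Filter ℝ) (𝓝 y) := by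
    intro x
    have hmem : ∀ᶠ r in (U : Filter ℝ), F r x / G r ∈ Set.Icc 0 ‖x‖ := by
      filter_upwards [hev] with r hr
      have := hG1 hr.1 hr.2
      exact ⟨div_nonneg (hF0 hr.1 hr.2 x) (by linarith),
        (div_le_iff₀ (by linarith)).2 (hFG hr.1 hr.2 x)⟩
    obtain ⟨y, -, hy⟩ := (isCompact_Icc (a := (0 : ℝ)) (b := ‖x‖)).ultrafilter_le_nhds
      (U.map fun r => F r x / G r) (Filter.le_principal_iff.2 hmem)
    exact ⟨y, hy⟩
  choose N hN using hex
  have hN0 : ∀ x, 0 ≤ N x := fun x => ge_of_tendsto (hN x) (by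
    filter_upwards [hev] with r hr
    exact div_nonneg (hF0 hr.1 hr.2 x) (by linarith [hG1 hr.1 hr.2]))
  have hNadd : ∀ x y, N (x + y) ≤ N x + N y := by
    intro x y
    refine le_of_tendsto_of_tendsto (hN _) ((hN x).add (hN y)) ?_
    filter_upwards [hev] with r hr
    rw [← add_div]
    refine div_le_div_of_nonneg_right ?_ (by linarith [hG1 hr.1 hr.2])
    refine ciSup_le fun t => ?_
    refine le_trans ?_ (add_le_add (hle hr.1 hr.2 t x) (hle hr.1 hr.2 t y))
    rw [← mul_add]
    exact mul_le_mul_of_nonneg_left (map_add_le_add _ _ _) (by have := hr.1; positivity)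
  have hNsmul : ∀ (a : ℝ) x, N (a • x) ≤ ‖a‖ * N x := by
    intro a x
    refine le_of_tendsto_of_tendsto (hN _) ((hN x).const_mul _) ?_
    filter_upwards [hev] with r hr
    rw [← mul_div_assoc]
    refine div_le_div_of_nonneg_right ?_ (by linarith [hG1 hr.1 hr.2])
    refine ciSup_le fun t => ?_
    rw [map_smul_eq_mul, mul_left_comm]
    exact mul_le_mul_of_nonneg_left (hle hr.1 hr.2 t x) (norm_nonneg _)
  have hNz : N 0 = 0 := le_antisymm (by simpa using hNsmul 0 0) (hN0 0)
  refine ⟨Seminorm.ofSMulLE N hNz hNadd hNsmul, ?_, ?_, ?_⟩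
  · by_contra! hzero
    have hz : ∀ x, N x = 0 := hzero
    have h2 : Tendsto (fun r => ∑ j, F r (Pi.single j 1) / G r) (U : Filter ℝ)
        (𝓝 (∑ j, N (Pi.single j 1))) := tendsto_finsetSum _ fun j _ => hN _
    -- The normalisation forces the limit values on the basis to sum to `1`, so the limit is not
    -- zero.
    have h3 : Tendsto (fun r => ∑ j, F r (Pi.single j 1) / G r) (U : Filter ℝ) (𝓝 1) := by
      refine (tendsto_const_nhds (x := (1 : ℝ))).congr' ?_
      filter_upwards [hev] with r hr
      rw [← Finset.sum_div]
      exact (div_self (by linarith [hG1 hr.1 hr.2] : (0 : ℝ) < G r).ne').symm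
    have := tendsto_nhds_unique h2 h3
    simp [hz] at this
  · intro i x
    show N _ ≤ N x
    -- Applying `A i` first shifts `t` by one, which gives `r * F r (A i *ᵥ x) ≤ F r x`; the factor
    -- `r` tends to `1`.
    have h2 := hid.mul (hN (A i *ᵥ x))
    rw [one_mul] at h2
    refine le_of_tendsto_of_tendsto h2 (hN x) ?_
    filter_upwards [hev] with r hr
    rw [← mul_div_assoc]
    refine div_le_div_of_nonneg_right ?_ (by linarith [hG1 hr.1 hr.2])
    rw [← le_div_iff₀' hr.1]
    refine ciSup_le fun t => ?_
    rw [le_div_iff₀' hr.1]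
    refine le_trans ?_ (hle hr.1 hr.2 (t + 1) x)
    have h0 := hr.1
    calc r * (((t : ℝ) + 1) * r ^ t * growth A t (A i *ᵥ x))
        = (((t : ℝ) + 1) * r ^ (t + 1)) * growth A t (A i *ᵥ x) := by ring
      _ ≤ (((t : ℝ) + 1) * r ^ (t + 1)) * growth A (t + 1) x :=
          mul_le_mul_of_nonneg_left (growth_mulVec_le A t i x) (by positivity)
      _ ≤ _ := by
          refine mul_le_mul_of_nonneg_right ?_ (apply_nonneg _ _)
          push_cast
          gcongr
          linarith
  · intro x
    show ∃ i, N x ≤ N (A i *ᵥ x)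
    obtain ⟨i₀, hi₀⟩ := Finite.exists_max fun i => N (A i *ᵥ x)
    refine ⟨i₀, le_of_forall_gt_imp_ge_of_dense fun y hy => ?_⟩
    have hy0 : 0 ≤ y := (hN0 _).trans hy.le
    have hevy : ∀ᶠ r in (U : Filter ℝ), ∀ i, F r (A i *ᵥ x) / G r < y :=
      eventually_all.2 fun i => (hN _).eventually (gt_mem_nhds ((hi₀ i).trans_lt hy))
    -- Terms with `t ≤ T` are at most the constant `c`, negligible against `G r`. In a later term `t
    -- = s + 1`, removing the first matrix costs the ratio of weights `(s + 2) / (s + 1)`, at most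
    -- `1 + 1 / (T + 1)`.
    have key : ∀ T : ℕ, N x ≤ (1 + 1 / ((T : ℝ) + 1)) * y := by
      intro T
      set c : ℝ := ∑ t ∈ Finset.range (T + 1), ((t : ℝ) + 1) * growth A t x with hc
      have hc0 : 0 ≤ c := Finset.sum_nonneg fun t _ => mul_nonneg (by positivity) (apply_nonneg _ _)
      have h2 : Tendsto (fun r => c / G r + (1 + 1 / ((T : ℝ) + 1)) * y) (U : Filter ℝ)
          (𝓝 (0 + (1 + 1 / ((T : ℝ) + 1)) * y)) :=
        (hGtop.const_div_atTop c).add_const _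
      rw [zero_add] at h2
      refine le_of_tendsto_of_tendsto (hN x) h2 ?_
      filter_upwards [hev, hevy] with r hr hry
      have hGr : 0 < G r := by linarith [hG1 hr.1 hr.2]
      have hr0 := hr.1
      rw [div_add' _ _ _ hGr.ne']
      refine div_le_div_of_nonneg_right ?_ hGr.le
      refine ciSup_le fun t => ?_
      rcases lt_or_ge t (T + 1) with ht | ht
      · have : ((t : ℝ) + 1) * r ^ t * growth A t x ≤ c := by
          refine le_trans ?_ (Finset.single_le_sum
            (f := fun t : ℕ => ((t : ℝ) + 1) * growth A t x)
            (fun t _ => mul_nonneg (by positivity) (apply_nonneg _ _)) (Finset.mem_range.2 ht))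
          refine mul_le_mul_of_nonneg_right ?_ (apply_nonneg _ _)
          exact mul_le_of_le_one_right (by positivity) (pow_le_one₀ hr0.le hr.2.le)
        have h5 : 0 ≤ (1 + 1 / ((T : ℝ) + 1)) * y * G r := by positivity
        linarith
      · obtain ⟨s, rfl⟩ : ∃ s, t = s + 1 := ⟨t - 1, by omega⟩
        have hTs : (T : ℝ) ≤ s := by exact_mod_cast (by omega : T ≤ s)
        obtain ⟨i, hi⟩ := exists_growth_succ A s x
        rw [hi]
        have h3 : ((s : ℝ) + 1) * r ^ s * growth A s (A i *ᵥ x) ≤ y * G r :=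
          (hle hr.1 hr.2 s _).trans ((div_lt_iff₀ hGr).1 (hry i)).le
        have h4 : (((s + 1 : ℕ) : ℝ) + 1) * r ^ (s + 1)
            ≤ (1 + 1 / ((T : ℝ) + 1)) * (((s : ℝ) + 1) * r ^ s) := by
          have h5 : ((s : ℝ) + 1) + 1 ≤ (1 + 1 / ((T : ℝ) + 1)) * ((s : ℝ) + 1) := by
            have : 1 ≤ 1 / ((T : ℝ) + 1) * ((s : ℝ) + 1) := by
              rw [div_mul_eq_mul_div, le_div_iff₀ (by positivity)]; linarith
            linarith
          have h6 : r ^ (s + 1) ≤ r ^ s := pow_le_pow_of_le_one hr0.le hr.2.le (by omega)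
          push_cast
          calc ((s : ℝ) + 1 + 1) * r ^ (s + 1)
              ≤ ((1 + 1 / ((T : ℝ) + 1)) * ((s : ℝ) + 1)) * r ^ s := by gcongr
            _ = _ := by ring
        have h7 : 0 ≤ growth A s (A i *ᵥ x) := apply_nonneg _ _
        calc (((s + 1 : ℕ) : ℝ) + 1) * r ^ (s + 1) * growth A s (A i *ᵥ x)
            ≤ (1 + 1 / ((T : ℝ) + 1)) * (((s : ℝ) + 1) * r ^ s) * growth A s (A i *ᵥ x) :=
              mul_le_mul_of_nonneg_right h4 h7
          _ = (1 + 1 / ((T : ℝ) + 1)) * (((s : ℝ) + 1) * r ^ s * growth A s (A i *ᵥ x)) := by ring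
          _ ≤ (1 + 1 / ((T : ℝ) + 1)) * (y * G r) := mul_le_mul_of_nonneg_left h3 (by positivity)
          _ ≤ _ := by linarith
    have hlim : Tendsto (fun T : ℕ => (1 + 1 / ((T : ℝ) + 1)) * y) atTop (𝓝 ((1 + 0) * y)) :=
      (tendsto_one_div_add_atTop_nhds_zero_nat.const_add 1).mul_const y
    simpa using ge_of_tendsto' hlim key

/-! ### Spectral gap, recurrence, and the contradiction for critical families. -/

lemma pow_card_le_norm_prod_one_sub {q : ℝ} (hq : q ≤ 1) (s : Multiset ℂ)
    (hs : ∀ z ∈ s, ‖z‖ ≤ q) : (1 - q) ^ s.card ≤ ‖(s.map fun z => 1 - z).prod‖ := by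
  induction s using Multiset.induction with
  | empty => simp
  | cons a s ih =>
    rw [Multiset.card_cons, Multiset.map_cons, Multiset.prod_cons, norm_mul, pow_succ']
    have ha : 1 - q ≤ ‖1 - a‖ := by
      have := norm_sub_norm_le (1 : ℂ) a
      rw [norm_one] at this
      linarith [hs a (Multiset.mem_cons_self a s)]
    exact mul_le_mul ha (ih fun z hz => hs z (Multiset.mem_cons_of_mem hz))
      (pow_nonneg (by linarith) _) (norm_nonneg _)

/-- A matrix that contracts a seminorm and has spectral radius at most `q < 1` moves every vector
by a fixed fraction of its seminorm. -/
theorem exists_gap {q : ℝ} (hq1 : q < 1) : ∃ c : ℝ, 0 < c ∧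
    ∀ (N : Seminorm ℝ (n → ℝ)) (P : Matrix n n ℝ), (∀ x, N (P *ᵥ x) ≤ N x) →
      (∀ z ∈ spectrum ℂ (P.map Complex.ofReal), ‖z‖ ≤ q) → ∀ y, c * N y ≤ N (y - P *ᵥ y) := by
  set d := Fintype.card n with hd
  -- `D` bounds the coefficients of a monic polynomial of degree `d` with all roots of modulus at
  -- most `q`. It depends on neither `N` nor `P`, which makes the gap uniform.
  set D : ℝ := max q 1 ^ d * d.choose (d / 2) with hD
  set S : ℝ := ∑ j ∈ Finset.range (d + 1), D * (j : ℝ) with hS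
  have hD0 : 0 ≤ D := by positivity
  have hS0 : 0 ≤ S := Finset.sum_nonneg fun j _ => by positivity
  have hq : 0 < (1 - q) ^ d := pow_pos (by linarith) _
  refine ⟨(1 - q) ^ d / (S + 1), by positivity, fun N P hNP hspec y => ?_⟩
  set χ := P.charpoly with hχ
  have hmap : (P.map Complex.ofReal).charpoly = χ.map Complex.ofRealHom :=
    Matrix.charpoly_map P Complex.ofRealHom
  have hroots : ∀ z ∈ (χ.map Complex.ofRealHom).roots, ‖z‖ ≤ q := fun z hz => by
    refine hspec z (Matrix.mem_spectrum_iff_isRoot_charpoly.2 ?_)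
    rw [hmap]
    exact Polynomial.isRoot_of_mem_roots hz
  have hmonic : χ.Monic := Matrix.charpoly_monic P
  have hdeg : χ.natDegree = d := Matrix.charpoly_natDegree_eq_dim P
  have hsplit : (χ.map Complex.ofRealHom).Splits := IsAlgClosed.splits _
  have hcoeff : ∀ j, |χ.coeff j| ≤ D := fun j => by
    have := Polynomial.coeff_bdd_of_roots_le Complex.ofRealHom hmonic hsplit hdeg.le hroots j
    simpa [Polynomial.coeff_map] using this
  have heval : (1 - q) ^ d ≤ |χ.eval 1| := by
    have h1 := hsplit.eval_eq_prod_roots_of_monic (hmonic.map _) 1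
    have h2 : ((χ.map Complex.ofRealHom).roots).card = d := by
      rw [← hsplit.natDegree_eq_card_roots, hmonic.natDegree_map, hdeg]
    have h3 := pow_card_le_norm_prod_one_sub hq1.le _ hroots
    rw [h2, ← h1, ← Complex.ofRealHom.map_one, Polynomial.eval_map_apply] at h3
    simpa using h3
  have hpow : ∀ j : ℕ, N (y - (P ^ j) *ᵥ y) ≤ j * N (y - P *ᵥ y) := by
    have hpw : ∀ (j : ℕ) x, N ((P ^ j) *ᵥ x) ≤ N x := by
      intro j
      induction j with
      | zero => simp
      | succ j ih =>
        intro x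
        rw [pow_succ, ← Matrix.mulVec_mulVec]
        exact (ih _).trans (hNP x)
    intro j
    induction j with
    | zero => simp
    | succ j ih =>
      have : y - (P ^ (j + 1)) *ᵥ y = (y - (P ^ j) *ᵥ y) + (P ^ j) *ᵥ (y - P *ᵥ y) := by
        rw [Matrix.mulVec_sub, Matrix.mulVec_mulVec, ← pow_succ]; abel
      rw [this]
      refine (map_add_le_add N _ _).trans ?_
      push_cast
      linarith [hpw j (y - P *ᵥ y)]
  -- By Cayley-Hamilton, subtracting `χ(P) y = 0` from `χ(1) y` leaves only differences `y - P ^ j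
  -- y`, which `hpow` controls by `y - P y`.
  have hCH : (χ.eval 1) • y = ∑ j ∈ Finset.range (d + 1), χ.coeff j • (y - (P ^ j) *ᵥ y) := by
    have h0 : (∑ j ∈ Finset.range (d + 1), χ.coeff j • (P ^ j)) *ᵥ y = 0 := by
      rw [← hdeg, ← Polynomial.aeval_eq_sum_range, Matrix.aeval_self_charpoly, Matrix.zero_mulVec]
    rw [Matrix.sum_mulVec] at h0
    simp only [Matrix.smul_mulVec] at h0
    simp only [smul_sub, Finset.sum_sub_distrib, h0, sub_zero]
    rw [Polynomial.eval_eq_sum_range, hdeg, ← Finset.sum_smul]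
    simp
  have hfin : (1 - q) ^ d * N y ≤ S * N (y - P *ᵥ y) := by
    calc (1 - q) ^ d * N y ≤ |χ.eval 1| * N y :=
          mul_le_mul_of_nonneg_right heval (apply_nonneg _ _)
      _ = N ((χ.eval 1) • y) := by rw [map_smul_eq_mul, Real.norm_eq_abs]
      _ ≤ ∑ j ∈ Finset.range (d + 1), N (χ.coeff j • (y - (P ^ j) *ᵥ y)) := by
          rw [hCH]
          exact Finset.le_sum_of_subadditive N (map_zero N).le (map_add_le_add N) _ _
      _ ≤ ∑ j ∈ Finset.range (d + 1), D * (j : ℝ) * N (y - P *ᵥ y) := by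
          refine Finset.sum_le_sum fun j _ => ?_
          rw [map_smul_eq_mul, Real.norm_eq_abs, mul_assoc]
          exact mul_le_mul (hcoeff j) (hpow j) (apply_nonneg _ _) hD0
      _ = S * N (y - P *ᵥ y) := by rw [hS, Finset.sum_mul]
  rw [div_mul_eq_mul_div, div_le_iff₀ (by positivity)]
  nlinarith [apply_nonneg N (y - P *ᵥ y)]

lemma continuous_seminorm_pi (N : Seminorm ℝ (n → ℝ)) : Continuous N := by
  have hL : LipschitzWith (Real.toNNReal (∑ j, N (Pi.single j 1))) N := by
    refine LipschitzWith.of_dist_le_mul fun x y => ?_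
    rw [Real.coe_toNNReal _ (Finset.sum_nonneg fun _ _ => apply_nonneg _ _), dist_eq_norm,
      dist_eq_norm, mul_comm]
    exact (abs_sub_map_le_sub N x y).trans (seminorm_le_norm_mul_sum N _)
  exact hL.continuous

/-- In finite dimension, a sequence on which a seminorm is bounded has two terms that are close
for the seminorm. -/
theorem exists_lt_seminorm_sub_lt (N : Seminorm ℝ (n → ℝ)) (x : ℕ → n → ℝ)
    (hx : ∀ t, N (x t) ≤ 1) {c : ℝ} (hc : 0 < c) : ∃ s t, s < t ∧ N (x s - x t) < c := by
  -- The seminorm may degenerate on its kernel `W`. On a complement `V` it dominates a multiple of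
  -- the norm, so Bolzano-Weierstrass applies to the components in `V`.
  let W : Submodule ℝ (n → ℝ) :=
    { carrier := {y | N y = 0}
      zero_mem' := map_zero N
      add_mem' := fun {a b} (ha : N a = 0) (hb : N b = 0) => le_antisymm
        ((map_add_le_add N a b).trans (by rw [ha, hb, add_zero])) (apply_nonneg _ _)
      smul_mem' := fun a y (hy : N y = 0) => by
        show N (a • y) = 0
        rw [map_smul_eq_mul, hy, mul_zero] }
  obtain ⟨V, hV⟩ := W.exists_isCompl
  have hcont := continuous_seminorm_pi N
  have hdec : ∀ t, ∃ v ∈ V, N (x t - v) = 0 := fun t => by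
    have : x t ∈ W ⊔ V := by rw [hV.sup_eq_top]; trivial
    obtain ⟨w, hw, v, hv, hwv⟩ := Submodule.mem_sup.1 this
    exact ⟨v, hv, by rw [← hwv, add_sub_cancel_right]; exact hw⟩
  choose v hvV hv using hdec
  have hNv : ∀ t, N (v t) ≤ 1 := fun t => by
    have h1 : v t = x t - (x t - v t) := by abel
    have h2 := map_sub_le_add N (x t) (x t - v t)
    rw [← h1, hv t] at h2
    linarith [hx t]
  have hbound : ∃ m : ℝ, 0 < m ∧ ∀ y ∈ V, m * ‖y‖ ≤ N y := by
    set K : Set (n → ℝ) := Metric.sphere 0 1 ∩ V with hK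
    have hKc : IsCompact K := (isCompact_sphere 0 1).inter_right V.closed_of_finiteDimensional
    have hpos : ∀ y ∈ K, 0 < N y := fun y hy => by
      refine lt_of_le_of_ne (apply_nonneg _ _) fun h => ?_
      have hy0 : y ∈ W ⊓ V := ⟨h.symm, hy.2⟩
      rw [hV.inf_eq_bot, Submodule.mem_bot] at hy0
      have := hy.1
      simp [hy0] at this
    obtain ⟨m, hm, hmK⟩ : ∃ m : ℝ, 0 < m ∧ ∀ y ∈ K, m ≤ N y := by
      rcases K.eq_empty_or_nonempty with h | h
      · exact ⟨1, one_pos, by simp [h]⟩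
      · obtain ⟨y, hy, hmin⟩ := hKc.exists_isMinOn h hcont.continuousOn
        exact ⟨N y, hpos y hy, fun z hz => hmin hz⟩
    refine ⟨m, hm, fun y hy => ?_⟩
    rcases eq_or_ne y 0 with rfl | hy0
    · simp
    · have h1 : ‖y‖⁻¹ • y ∈ K := ⟨by simp [norm_smul, hy0], V.smul_mem _ hy⟩
      have h2 := hmK _ h1
      rw [map_smul_eq_mul, norm_inv, norm_norm, inv_mul_eq_div,
        le_div_iff₀ (norm_pos_iff.2 hy0)] at h2
      exact h2
  obtain ⟨m, hm, hmV⟩ := hbound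
  have hmem : ∀ t, v t ∈ Metric.closedBall (0 : n → ℝ) (1 / m) := fun t => by
    rw [mem_closedBall_zero_iff, le_div_iff₀ hm, mul_comm]
    exact (hmV _ (hvV t)).trans (hNv t)
  obtain ⟨a, -, φ, hφ, hlim⟩ := (isCompact_closedBall (0 : n → ℝ) (1 / m)).tendsto_subseq hmem
  have hlim0 : Tendsto (fun t => N (v (φ t) - a)) atTop (𝓝 0) := by
    have := (hcont.tendsto (a - a)).comp (hlim.sub_const a)
    rwa [sub_self, map_zero] at this
  obtain ⟨T, hT⟩ := (hlim0.eventually (gt_mem_nhds (half_pos hc))).exists_forall_of_atTop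
  refine ⟨φ T, φ (T + 1), hφ (Nat.lt_succ_self T), ?_⟩
  have e : x (φ T) - x (φ (T + 1)) = ((x (φ T) - v (φ T)) - (x (φ (T + 1)) - v (φ (T + 1))))
      + ((v (φ T) - a) - (v (φ (T + 1)) - a)) := by abel
  rw [e]
  have h1 := map_add_le_add N ((x (φ T) - v (φ T)) - (x (φ (T + 1)) - v (φ (T + 1))))
    ((v (φ T) - a) - (v (φ (T + 1)) - a))
  have h2 := map_sub_le_add N (x (φ T) - v (φ T)) (x (φ (T + 1)) - v (φ (T + 1)))
  have h3 := map_sub_le_add N (v (φ T) - a) (v (φ (T + 1)) - a)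
  rw [hv, hv] at h2
  linarith [hT T le_rfl, hT (T + 1) (Nat.le_succ T)]

/-- A critical family has products whose spectral radii are not bounded away from `1`. -/
theorem not_critical_of_spectrum_le [Nonempty ι] (A : ι → Matrix n n ℝ)
    (h1 : ∀ t, 1 ≤ totalGrowth A t)
    (hb : ∀ r : ℝ, 0 < r → r < 1 → ∃ C, ∀ t, r ^ t * totalGrowth A t ≤ C)
    {q : ℝ} (hq1 : q < 1)
    (hspec : ∀ t, 1 ≤ t → ∀ P ∈ (Set.range A) ^ t,
      ∀ z ∈ spectrum ℂ (P.map Complex.ofReal), ‖z‖ ≤ q) : False := by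
  obtain ⟨N, ⟨y, hy⟩, hcontr, hexp⟩ := exists_extremal_seminorm A h1 hb
  have hy0 : 0 < N y := lt_of_le_of_ne (apply_nonneg _ _) (Ne.symm hy)
  obtain ⟨c, hc, hgap⟩ := exists_gap (n := n) hq1
  choose i hi using hexp
  -- Applying at each state a matrix that does not decrease `N` keeps the orbit on the unit sphere
  -- of `N`.
  let x : ℕ → n → ℝ := fun t => (fun z => A (i z) *ᵥ z)^[t] ((N y)⁻¹ • y)
  have hxs : ∀ t, x (t + 1) = A (i (x t)) *ᵥ x t := fun t =>
    Function.iterate_succ_apply' _ _ _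
  have hNx : ∀ t, N (x t) = 1 := by
    intro t
    induction t with
    | zero =>
      show N ((N y)⁻¹ • y) = 1
      rw [map_smul_eq_mul, norm_inv, Real.norm_of_nonneg hy0.le, inv_mul_cancel₀ hy]
    | succ t ih =>
      rw [hxs, ← ih]
      exact le_antisymm (hcontr _ _) (hi _)
  have hprod : ∀ s t, ∃ P ∈ (Set.range A) ^ t, x (s + t) = P *ᵥ x s := by
    intro s t
    induction t with
    | zero => exact ⟨1, by simp, by simp⟩
    | succ t ih =>
      obtain ⟨P, hP, hPx⟩ := ih
      refine ⟨A (i (x (s + t))) * P, ?_, ?_⟩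
      · rw [pow_succ']
        exact Set.mul_mem_mul ⟨_, rfl⟩ hP
      · rw [← add_assoc, hxs, ← Matrix.mulVec_mulVec, ← hPx]
  have hNP : ∀ t, ∀ P ∈ (Set.range A) ^ t, ∀ z, N (P *ᵥ z) ≤ N z := by
    intro t
    induction t with
    | zero =>
      intro P hP z
      rw [pow_zero, Set.mem_one] at hP
      simp [hP]
    | succ t ih =>
      intro P hP z
      rw [pow_succ] at hP
      obtain ⟨P', hP', _, ⟨j, rfl⟩, rfl⟩ := hP
      rw [← Matrix.mulVec_mulVec]
      exact (ih P' hP' _).trans (hcontr j z)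
  obtain ⟨s, t, hst, hlt⟩ := exists_lt_seminorm_sub_lt N x (fun t => (hNx t).le) hc
  obtain ⟨P, hP, hPx⟩ := hprod s (t - s)
  rw [Nat.add_sub_cancel' hst.le] at hPx
  -- The product `P` carries `x s` to `x t`, closer than `c` to it, although the gap requires a
  -- displacement of at least `c * N (x s) = c`.
  have := hgap N P (hNP _ P hP) (hspec _ (by omega) P hP) (x s)
  rw [hNx, ← hPx] at this
  linarith

/-- By submultiplicativity, blocks of length `T` can be split off until fewer than `T` factors
remain; the constant covers these remainders. -/
lemma totalGrowth_le_of_le_pow [Nonempty ι] (A : ι → Matrix n n ℝ) {l : ℝ} (hl : 0 < l) {T : ℕ}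
    (hT : 1 ≤ T) (h : totalGrowth A T ≤ l ^ T) : ∃ C, ∀ t, totalGrowth A t ≤ C * l ^ t := by
  refine ⟨∑ s ∈ Finset.range T, totalGrowth A s / l ^ s, fun t => ?_⟩
  induction t using Nat.strong_induction_on with
  | _ t ih =>
    rcases lt_or_ge t T with ht | ht
    · have h1 := Finset.single_le_sum (f := fun s => totalGrowth A s / l ^ s)
        (fun s _ => div_nonneg (totalGrowth_nonneg A s) (by positivity)) (Finset.mem_range.2 ht)
      exact (div_le_iff₀ (by positivity)).1 h1
    · obtain ⟨s, rfl⟩ := Nat.exists_eq_add_of_le ht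
      calc totalGrowth A (T + s) ≤ totalGrowth A T * totalGrowth A s := totalGrowth_add_le A T s
        _ ≤ l ^ T * ((∑ s ∈ Finset.range T, totalGrowth A s / l ^ s) * l ^ s) :=
            mul_le_mul h (ih s (by omega)) (totalGrowth_nonneg A s) (by positivity)
        _ = _ := by rw [pow_add]; ring

lemma exists_eq_smul_of_mem_range_smul_pow (A : ι → Matrix n n ℝ) (s : ℝ) (t : ℕ)
    {P : Matrix n n ℝ} (hP : P ∈ (Set.range fun i => s • A i) ^ t) :
    ∃ Q ∈ (Set.range A) ^ t, P = s ^ t • Q := by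
  induction t generalizing P with
  | zero => exact ⟨1, by simp, by simpa using hP⟩
  | succ t ih =>
    rw [pow_succ] at hP
    obtain ⟨P', hP', _, ⟨i, rfl⟩, rfl⟩ := hP
    obtain ⟨Q, hQ, rfl⟩ := ih hP'
    refine ⟨Q * A i, by rw [pow_succ]; exact Set.mul_mem_mul hQ ⟨i, rfl⟩, ?_⟩
    simp only [Matrix.smul_mul, Matrix.mul_smul, smul_smul, pow_succ, mul_comm]

/-- The Berger-Wang inequality: a bound for the spectral radii of all products of a finite family
yields a bound for their norms. -/
theorem exists_totalGrowth_le [Nonempty ι] (A : ι → Matrix n n ℝ) {ρ l : ℝ} (hρ : 0 ≤ ρ)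
    (hρl : ρ < l)
    (hspec : ∀ t, 1 ≤ t → ∀ P ∈ (Set.range A) ^ t,
      ∀ z ∈ spectrum ℂ (P.map Complex.ofReal), ‖z‖ ≤ ρ ^ t) :
    ∃ C, ∀ t, totalGrowth A t ≤ C * l ^ t := by
  by_contra hcon
  have hl : 0 < l := hρ.trans_lt hρl
  set S : Set ℝ := {m | 0 < m ∧ ∃ C, ∀ t, totalGrowth A t ≤ C * m ^ t} with hS
  have hlb : ∀ m ∈ S, l ≤ m := by
    rintro m ⟨hm, C, hC⟩
    by_contra! hml
    refine hcon ⟨C, fun t => (hC t).trans ?_⟩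
    have hC0 : 0 ≤ C := by simpa using (totalGrowth_nonneg A 0).trans (hC 0)
    gcongr
  have hne : S.Nonempty := by
    refine ⟨totalGrowth A 1 + 1, by linarith [totalGrowth_nonneg A 1], ?_⟩
    exact totalGrowth_le_of_le_pow A (by linarith [totalGrowth_nonneg A 1]) le_rfl
      (by rw [pow_one]; linarith)
  -- `Λ` is the optimal growth rate. The family rescaled by `Λ⁻¹` is critical, yet its products have
  -- spectral radius at most `ρ / Λ < 1`.
  set Λ := sInf S with hΛ
  have hlΛ : l ≤ Λ := le_csInf hne hlb
  have hΛ0 : 0 < Λ := hl.trans_le hlΛ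
  have hbdd : BddBelow S := ⟨l, hlb⟩
  refine not_critical_of_spectrum_le (fun i => Λ⁻¹ • A i) ?_ ?_ (q := ρ / Λ)
    ((div_lt_one hΛ0).2 (hρl.trans_le hlΛ)) ?_
  · intro T
    by_contra! hT
    rw [totalGrowth_smul A (inv_nonneg.2 hΛ0.le), inv_pow, inv_mul_eq_div,
      div_lt_one (by positivity)] at hT
    rcases Nat.eq_zero_or_pos T with rfl | hT0
    -- Here `totalGrowth A 0 < 1`, and submultiplicativity with `T = 0` forces every `totalGrowth A
    -- t` to vanish.
    · refine hcon ⟨0, fun t => ?_⟩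
      have h1 := totalGrowth_add_le A 0 t
      rw [zero_add] at h1
      rw [pow_zero] at hT
      nlinarith [totalGrowth_nonneg A t]
    · have h1 : ∀ᶠ m in 𝓝[<] Λ, totalGrowth A T < m ^ T :=
        (((continuous_pow T).tendsto Λ).mono_left nhdsWithin_le_nhds).eventually (lt_mem_nhds hT)
      have h2 : ∀ᶠ m in 𝓝[<] Λ, m ∈ Set.Ioo 0 Λ := Ioo_mem_nhdsLT hΛ0
      obtain ⟨m, hm, hm0, hmΛ⟩ := (h1.and h2).exists
      have hmS : m ∈ S := ⟨hm0, totalGrowth_le_of_le_pow A hm0 hT0 hm.le⟩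
      exact absurd (csInf_le hbdd hmS) (not_le.2 hmΛ)
  · intro r hr0 hr1
    have h1 : sInf S < Λ / r := by
      rw [← hΛ, lt_div_iff₀ hr0]
      nlinarith
    obtain ⟨m, ⟨hm0, C, hC⟩, hm⟩ := exists_lt_of_csInf_lt hne h1
    have hC0 : 0 ≤ C := by simpa using (totalGrowth_nonneg A 0).trans (hC 0)
    refine ⟨C, fun t => ?_⟩
    rw [totalGrowth_smul A (inv_nonneg.2 hΛ0.le)]
    have h2 : r * Λ⁻¹ * m ≤ 1 := by
      rw [lt_div_iff₀ hr0] at hm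
      rw [mul_right_comm, ← div_eq_mul_inv, div_le_one hΛ0]
      linarith
    calc r ^ t * (Λ⁻¹ ^ t * totalGrowth A t) ≤ r ^ t * (Λ⁻¹ ^ t * (C * m ^ t)) := by
          gcongr
          exact hC t
      _ = C * (r * Λ⁻¹ * m) ^ t := by rw [mul_pow, mul_pow]; ring
      _ ≤ C := mul_le_of_le_one_right hC0 (pow_le_one₀ (by positivity) h2)
  · intro t ht P hP z hz
    obtain ⟨Q, hQ, rfl⟩ := exists_eq_smul_of_mem_range_smul_pow A _ t hP
    have hu : ((Λ ^ t : ℝ) : ℂ) ≠ 0 := by exact_mod_cast (pow_pos hΛ0 t).ne'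
    have hz' : ((Λ ^ t : ℝ) : ℂ) * z ∈ spectrum ℂ (Q.map Complex.ofReal) := by
      have h1 : Q.map Complex.ofReal
          = (Units.mk0 _ hu) • ((Λ⁻¹ ^ t • Q).map Complex.ofReal) := by
        ext a b
        simp only [Units.smul_def, Matrix.smul_apply, Matrix.map_apply, Units.val_mk0, smul_eq_mul]
        rw [← Complex.ofReal_mul, ← mul_assoc, ← mul_pow, mul_inv_cancel₀ hΛ0.ne', one_pow, one_mul]
      rw [h1, spectrum.unit_smul_eq_smul]
      exact ⟨z, hz, rfl⟩
    have h2 := hspec t ht Q hQ _ hz'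
    rw [norm_mul, Complex.norm_real, Real.norm_of_nonneg (by positivity)] at h2
    have h3 : ‖z‖ ≤ (ρ / Λ) ^ t := by
      rw [div_pow, le_div_iff₀ (by positivity)]
      linarith
    refine h3.trans (pow_le_of_le_one (by positivity) ?_ (by omega))
    exact ((div_lt_one hΛ0).2 (hρl.trans_le hlΛ)).le

/-! ### Joint spectral radius of a convex hull. -/

/-- An upper limit only constrains long products, but every power of `P` is again a product, so a
bound for a high power descends to `P`. -/
lemma norm_le_pow_of_jsr_lt {𝒜 : Set (Matrix n n ℝ)} {ρ : ℝ} (hρ : 0 ≤ ρ)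
    (h : jsr 𝒜 < ENNReal.ofReal ρ) {t : ℕ} (ht : 1 ≤ t) {P : Matrix n n ℝ} (hP : P ∈ 𝒜 ^ t) {z : ℂ}
    (hz : z ∈ spectrum ℂ (P.map Complex.ofReal)) : ‖z‖ ≤ ρ ^ t := by
  have hev := Filter.eventually_lt_of_limsup_lt h
  obtain ⟨m₀, hm₀⟩ := eventually_atTop.1 hev
  set m := m₀ + 1 with hm
  have h1 := hm₀ (t * m) (by nlinarith)
  have hPm : P ^ m ∈ 𝒜 ^ (t * m) := by
    rw [pow_mul]
    exact Set.pow_mem_pow hP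
  have hzm : z ^ m ∈ spectrum ℂ ((P ^ m).map Complex.ofReal) := by
    have : (P ^ m).map Complex.ofReal = (P.map Complex.ofReal) ^ m :=
      map_pow Complex.ofRealHom.mapMatrix P m
    rw [this]
    exact spectrum.pow_mem_pow _ m hz
  have htm : (0 : ℝ) < ((t * m : ℕ) : ℝ) := by
    have : 0 < t * m := by positivity
    exact_mod_cast this
  have h2 : spectralRadius ℂ ((P ^ m).map Complex.ofReal) ^ (1 / ((t * m : ℕ) : ℝ))
      ≤ ENNReal.ofReal ρ :=
    (le_iSup₂ (f := fun B (_ : B ∈ 𝒜 ^ (t * m)) =>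
      spectralRadius ℂ (B.map Complex.ofReal) ^ (1 / ((t * m : ℕ) : ℝ))) _ hPm).trans h1.le
  rw [one_div, ENNReal.rpow_inv_le_iff htm, ENNReal.rpow_natCast] at h2
  have h3 : (‖z ^ m‖₊ : ℝ≥0∞) ≤ ENNReal.ofReal ρ ^ (t * m) :=
    (le_iSup₂ (f := fun k (_ : k ∈ spectrum ℂ ((P ^ m).map Complex.ofReal)) =>
      (‖k‖₊ : ℝ≥0∞)) _ hzm).trans h2
  rw [← ENNReal.ofReal_pow hρ, ← enorm_eq_nnnorm, ← ofReal_norm,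
    ENNReal.ofReal_le_ofReal_iff (by positivity), norm_pow, pow_mul] at h3
  exact (pow_le_pow_iff_left₀ (norm_nonneg _) (by positivity) (by omega)).1 h3

lemma jsr_le_of_norm_le {𝒜 : Set (Matrix n n ℝ)} {C l : ℝ} (hC : 0 < C) (hl : 0 ≤ l)
    (h : ∀ t, ∀ P ∈ 𝒜 ^ t, ∀ z ∈ spectrum ℂ (P.map Complex.ofReal), ‖z‖ ≤ C * l ^ t) :
    jsr 𝒜 ≤ ENNReal.ofReal l := by
  have hlim : Tendsto (fun t : ℕ => ENNReal.ofReal (C ^ (1 / (t : ℝ)) * l)) atTop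
      (𝓝 (ENNReal.ofReal l)) := by
    refine (ENNReal.continuous_ofReal.tendsto l).comp ?_
    have h1 : Tendsto (fun t : ℕ => C ^ (1 / (t : ℝ))) atTop (𝓝 (C ^ (0 : ℝ))) :=
      ((Real.continuousAt_const_rpow hC.ne').tendsto).comp tendsto_one_div_atTop_nhds_zero_nat
    simpa using h1.mul_const l
  rw [← hlim.limsup_eq]
  refine Filter.limsup_le_limsup ?_
  filter_upwards [eventually_ge_atTop 1] with t ht
  have ht0 : (0 : ℝ) < t := by exact_mod_cast ht
  refine iSup₂_le fun P hP => ?_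
  rw [one_div, ENNReal.rpow_inv_le_iff ht0, ENNReal.rpow_natCast]
  refine iSup₂_le fun z hz => ?_
  rw [← ENNReal.ofReal_pow (by positivity), ← enorm_eq_nnnorm, ← ofReal_norm]
  refine ENNReal.ofReal_le_ofReal ((h t P hP z hz).trans_eq ?_)
  rw [mul_pow, ← Real.rpow_natCast (C ^ (t : ℝ)⁻¹), ← Real.rpow_mul hC.le,
    inv_mul_cancel₀ ht0.ne', Real.rpow_one]

/-- By Gershgorin, an eigenvalue is bounded by an absolute row sum. The dimensional factor is
harmless, as `t`-th roots remove it. -/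
lemma norm_spectrum_le {B : Matrix n n ℝ} {D : ℝ} (hB : ∀ x, ‖B *ᵥ x‖ ≤ D * ‖x‖) {z : ℂ}
    (hz : z ∈ spectrum ℂ (B.map Complex.ofReal)) : ‖z‖ ≤ Fintype.card n * D := by
  have hent : ∀ i j, |B i j| ≤ D := fun i j => by
    have h1 := (norm_le_pi_norm (B *ᵥ Pi.single j 1) i).trans (hB (Pi.single j 1))
    simpa [Pi.norm_single] using h1
  rw [← Matrix.spectrum_toLin', ← Module.End.hasEigenvalue_iff_mem_spectrum] at hz
  obtain ⟨k, hk⟩ := eigenvalue_mem_ball hz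
  rw [mem_closedBall_iff_norm] at hk
  have h1 : ‖z‖ ≤ ∑ j, ‖(B.map Complex.ofReal) k j‖ := by
    rw [← Finset.sum_erase_add _ _ (Finset.mem_univ k)]
    have := norm_sub_norm_le z ((B.map Complex.ofReal) k k)
    linarith
  refine h1.trans ?_
  calc ∑ j, ‖(B.map Complex.ofReal) k j‖ ≤ ∑ _j : n, D :=
        Finset.sum_le_sum fun j _ => by simpa using hent k j
    _ = _ := by simp

/-- The prefix `M` of genuine members makes the induction run: with the other factors fixed, the
bound is a convex condition on the leftmost hull factor, so that factor may be taken to be some `A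
i` and absorbed into `M`. -/
lemma norm_mulVec_convexHull_pow_le (A : ι → Matrix n n ℝ) {C l : ℝ}
    (hC : ∀ t, totalGrowth A t ≤ C * l ^ t) (t : ℕ) {B : Matrix n n ℝ}
    (hB : B ∈ (convexHull ℝ (Set.range A)) ^ t) (s : ℕ) {M : Matrix n n ℝ}
    (hM : M ∈ (Set.range A) ^ s) (x : n → ℝ) : ‖(M * B) *ᵥ x‖ ≤ C * l ^ (s + t) * ‖x‖ := by
  induction t generalizing s M B with
  | zero =>
    rw [pow_zero, Set.mem_one] at hB
    rw [hB, mul_one, add_zero, mul_comm]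
    exact (norm_mulVec_le_growth A s hM x).trans ((growth_le A s x).trans
      (mul_le_mul_of_nonneg_left (hC s) (norm_nonneg _)))
  | succ t ih =>
    rw [pow_succ'] at hB
    obtain ⟨X, hX, B', hB', rfl⟩ := hB
    have hconv : convexHull ℝ (Set.range A)
        ⊆ {X | ‖(M * (X * B')) *ᵥ x‖ ≤ C * l ^ (s + (t + 1)) * ‖x‖} := by
      refine convexHull_min ?_ ?_
      · rintro _ ⟨i, rfl⟩
        have := ih hB' (s + 1) (M := M * A i)
          (by rw [pow_succ]; exact Set.mul_mem_mul hM ⟨i, rfl⟩)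
        rw [mul_assoc, add_assoc, add_comm 1 t] at this
        exact this
      · intro X hX Y hY a b ha hb hab
        simp only [Set.mem_ofPred_eq] at hX hY ⊢
        have e : (M * ((a • X + b • Y) * B')) *ᵥ x
            = a • ((M * (X * B')) *ᵥ x) + b • ((M * (Y * B')) *ᵥ x) := by
          rw [add_mul, mul_add, Matrix.add_mulVec]
          simp only [Matrix.smul_mul, Matrix.mul_smul, Matrix.smul_mulVec]
        rw [e]
        refine (norm_add_le _ _).trans ?_
        rw [norm_smul, norm_smul, Real.norm_of_nonneg ha, Real.norm_of_nonneg hb]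
        calc _ ≤ a * (C * l ^ (s + (t + 1)) * ‖x‖) + b * (C * l ^ (s + (t + 1)) * ‖x‖) := by gcongr
          _ = _ := by rw [← add_mul, hab, one_mul]
    exact hconv hX

/-- The joint spectral radius of a finite family is not increased by passing to convex hulls. -/
theorem jsr_convexHull_range_le [Nonempty ι] (A : ι → Matrix n n ℝ) {ρ : ℝ} (hρ : 0 ≤ ρ)
    (h : jsr (Set.range A) ≤ ENNReal.ofReal ρ) :
    jsr (convexHull ℝ (Set.range A)) ≤ ENNReal.ofReal ρ := by
  have key : ∀ l, ρ < l → jsr (convexHull ℝ (Set.range A)) ≤ ENNReal.ofReal l := by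
    intro l hl
    -- Two strict inequalities are needed: `ρ < m` turns the upper limit into bounds for all
    -- products, and `m < l` is the room that Berger-Wang uses.
    obtain ⟨m, hm, hml⟩ := exists_between hl
    have hm0 : 0 < m := hρ.trans_lt hm
    have hl0 : 0 < l := hm0.trans hml
    obtain ⟨C, hC⟩ := exists_totalGrowth_le A hm0.le hml fun t ht P hP z hz =>
      norm_le_pow_of_jsr_lt hm0.le (h.trans_lt ((ENNReal.ofReal_lt_ofReal_iff hm0).2 hm)) ht hP hz
    have hC0 : 0 ≤ C := by simpa using (totalGrowth_nonneg A 0).trans (hC 0)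
    refine jsr_le_of_norm_le (C := Fintype.card n * C + 1) (by positivity) hl0.le ?_
    intro t B hB z hz
    have h1 := norm_spectrum_le (D := C * l ^ t) (fun x => by
      have := norm_mulVec_convexHull_pow_le A hC t hB 0 (M := 1) (by simp) x
      simpa using this) hz
    have h2 : 0 ≤ l ^ t := by positivity
    linarith
  refine ge_of_tendsto (x := 𝓝[>] ρ) ((ENNReal.continuous_ofReal.tendsto ρ).mono_left
    nhdsWithin_le_nhds) ?_
  filter_upwards [self_mem_nhdsWithin] with l hl
  exact key l hl

lemma jsr_mono {𝒜 ℬ : Set (Matrix n n ℝ)} (h : 𝒜 ⊆ ℬ) : jsr 𝒜 ≤ jsr ℬ := by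
  refine Filter.limsup_le_limsup (Eventually.of_forall fun t => ?_)
  exact biSup_mono fun B hB => Set.pow_subset_pow_left h hB

end BergerWang

variable {k p r L : ℕ}

open MeasureTheory

/-! ### Increments and averages in closed convex sets. -/

section ConvexHull

variable {E : Type*} [NormedAddCommGroup E] [NormedSpace ℝ E]

lemma exists_weights_of_mem_convexHull_range {V : Type*} [AddCommGroup V] [Module ℝ V] {ι : Type*}
    [Fintype ι] {v : ι → V} {x : V}
    (hx : x ∈ convexHull ℝ (Set.range v)) :
    ∃ w : ι → ℝ, (∀ i, 0 ≤ w i) ∧ ∑ i, w i = 1 ∧ x = ∑ i, w i • v i := by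
  classical
  have hsub : convexHull ℝ (Set.range v)
      ⊆ (fun w : ι → ℝ => ∑ i, w i • v i) '' stdSimplex ℝ ι := by
    refine convexHull_min ?_ ?_
    · rintro _ ⟨i, rfl⟩
      exact ⟨Pi.single i 1, single_mem_stdSimplex ℝ i, by simp [Pi.single_apply, ite_smul]⟩
    · rintro _ ⟨w, hw, rfl⟩ _ ⟨w', hw', rfl⟩ a b ha hb hab
      refine ⟨a • w + b • w', convex_stdSimplex ℝ ι hw hw' ha hb hab, ?_⟩
      simp only [Pi.add_apply, Pi.smul_apply, smul_eq_mul, add_smul, mul_smul,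
        Finset.sum_add_distrib, Finset.smul_sum]
  obtain ⟨w, hw, rfl⟩ := hsub hx
  exact ⟨w, hw.1, hw.2, rfl⟩

/-- Only a least or a greatest element can fail to be interior. -/
lemma countable_diff_interior_of_ordConnected {I : Set ℝ} (hI : I.OrdConnected) :
    (I \ interior I).Countable := by
  have hsub : I \ interior I ⊆ {t | IsLeast I t} ∪ {t | IsGreatest I t} := by
    rintro t ⟨ht, hti⟩
    by_contra hcon
    rw [Set.mem_union, not_or] at hcon
    obtain ⟨h1, h2⟩ := hcon
    obtain ⟨a, ha, hat⟩ : ∃ a ∈ I, a < t := by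
      by_contra! h
      exact h1 ⟨ht, fun s hs => h s hs⟩
    obtain ⟨b, hb, htb⟩ : ∃ b ∈ I, t < b := by
      by_contra! h
      exact h2 ⟨ht, fun s hs => h s hs⟩
    refine hti (mem_interior_iff_mem_nhds.2 (Filter.mem_of_superset (Icc_mem_nhds hat htb) ?_))
    exact hI.out ha hb
  refine Set.Countable.mono hsub (Set.Countable.union ?_ ?_)
  · exact Set.Subsingleton.countable fun a ha b hb => IsLeast.unique ha hb
  · exact Set.Subsingleton.countable fun a ha b hb => IsGreatest.unique ha hb

/-- The increment over `[0, 1]` of a continuous piecewise affine curve is a convex combination of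
its slopes. -/
theorem sub_mem_convexHull_of_piecewise_affine [CompleteSpace E] {F : ℝ → E} (hF : Continuous F)
    (I : Fin L → Set ℝ) (hI : ∀ ℓ, (I ℓ).OrdConnected)
    (hdisj : Pairwise fun ℓ ℓ' => Disjoint (I ℓ) (I ℓ')) (hcov : ∀ t, ∃ ℓ, t ∈ I ℓ)
    (c d : Fin L → E) (haff : ∀ ℓ, ∀ t ∈ I ℓ, F t = c ℓ + t • d ℓ) :
    F 1 - F 0 ∈ convexHull ℝ (Set.range d) := by
  set F' : ℝ → E := fun t => ∑ ℓ, (I ℓ).indicator (fun _ => d ℓ) t with hF'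
  have hval : ∀ ℓ, ∀ t ∈ I ℓ, F' t = d ℓ := fun ℓ t ht => by
    rw [hF']
    simp only
    rw [Finset.sum_eq_single ℓ, Set.indicator_of_mem ht]
    · intro ℓ' _ hne
      exact Set.indicator_of_notMem (fun h => Set.disjoint_left.1 (hdisj hne) h ht) _
    · simp
  have hint : ∀ s : Set ℝ, volume s ≠ ∞ → IntegrableOn F' s := fun s hs => by
    refine integrable_finsetSum _ fun ℓ _ => ?_
    exact (integrableOn_const hs).indicator (hI ℓ).measurableSet
  -- Off the endpoints of the intervals, `F` has the slope of its piece as derivative. Continuity of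
  -- `F` then makes its increment the integral of the slopes.
  have hFTC := MeasureTheory.integral_eq_of_hasDerivAt_off_countable F F'
    (a := 0) (b := 1) (s := ⋃ ℓ, I ℓ \ interior (I ℓ))
    (Set.countable_iUnion fun ℓ => countable_diff_interior_of_ordConnected (hI ℓ))
    hF.continuousOn (fun t ht => by
      obtain ⟨ℓ, hℓ⟩ := hcov t
      have hti : t ∈ interior (I ℓ) := by
        by_contra h
        exact ht.2 (Set.mem_iUnion.2 ⟨ℓ, hℓ, h⟩)
      rw [hval ℓ t hℓ]
      have h1 : HasDerivAt (fun t : ℝ => c ℓ + t • d ℓ) (d ℓ) t := by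
        simpa using ((hasDerivAt_id t).smul_const (d ℓ)).const_add (c ℓ)
      refine h1.congr_of_eventuallyEq ?_
      filter_upwards [mem_interior_iff_mem_nhds.1 hti] with s hs
      exact haff ℓ s hs)
    ((intervalIntegrable_iff_integrableOn_Ioc_of_le zero_le_one).2 (hint _ (by simp)))
  rw [← hFTC, intervalIntegral.integral_of_le zero_le_one]
  have : IsProbabilityMeasure (volume.restrict (Set.Ioc (0 : ℝ) 1)) := ⟨by simp⟩
  refine (convex_convexHull ℝ _).integral_mem ((Set.finite_range d).isClosed_convexHull ℝ) ?_
    (hint _ (by simp))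
  refine Filter.Eventually.of_forall fun t => ?_
  obtain ⟨ℓ, hℓ⟩ := hcov t
  rw [hval ℓ t hℓ]
  exact subset_convexHull ℝ _ ⟨ℓ, rfl⟩

/-- Averages with respect to a probability density stay in closed convex sets. -/
theorem integral_density_smul_mem [CompleteSpace E] {X : Type*} [MeasurableSpace X]
    {m : Measure X} {K : X → ℝ} (hK : Measurable K) (hK0 : ∀ u, 0 ≤ K u) (hK1 : ∫ u, K u ∂m = 1)
    {C : Set E} (hC : Convex ℝ C) (hCc : IsClosed C) {g : X → E} (hg : ∀ u, g u ∈ C)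
    (hint : Integrable (fun u => K u • g u) m) : ∫ u, K u • g u ∂m ∈ C := by
  have hKi : Integrable K m := by
    by_contra h
    rw [integral_undef h] at hK1
    exact zero_ne_one hK1
  set q : X → NNReal := fun u => (K u).toNNReal with hq
  have hqm : Measurable q := hK.real_toNNReal
  have hqK : ∀ u, q u • g u = K u • g u := fun u => by
    rw [NNReal.smul_def, Real.coe_toNNReal _ (hK0 u)]
  have hprob : IsProbabilityMeasure (m.withDensity fun u => (q u : ℝ≥0∞)) := ⟨by
    rw [withDensity_apply _ MeasurableSet.univ, Measure.restrict_univ]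
    have := ofReal_integral_eq_lintegral_ofReal hKi (Filter.Eventually.of_forall hK0)
    rw [hK1, ENNReal.ofReal_one] at this
    exact this.symm⟩
  have hmem := hC.integral_mem hCc (μ := m.withDensity fun u => (q u : ℝ≥0∞))
    (Filter.Eventually.of_forall hg)
    ((integrable_withDensity_iff_integrable_smul hqm).2 (by simpa only [hqK] using hint))
  rw [integral_withDensity_eq_integral_smul hqm] at hmem
  simpa only [hqK] using hmem

end ConvexHull

/-! ### Increments of piecewise affine models. -/

section PiecewiseAffine

variable {Z : Fin L → Set (Fin p → ℝ)} {φ : Fin (k + 1) → Fin L → (Fin p → ℝ)}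
  {Φ : Fin (k + 1) → Fin L → Matrix (Fin p) (Fin p) ℝ}
  {f : Fin (k + 1) → (Fin p → ℝ) → (Fin p → ℝ)}

lemma IsPiecewiseAffineVAR.exists_mem (h : IsPiecewiseAffineVAR Z φ Φ f) (z : Fin p → ℝ) :
    ∃ ℓ, z ∈ Z ℓ := by
  have : z ∈ ⋃ ℓ, Z ℓ := by rw [h.cover]; trivial
  exact Set.mem_iUnion.1 this

lemma IsPiecewiseAffineVAR.apply_of_mem (h : IsPiecewiseAffineVAR Z φ Φ f) (i : Fin (k + 1))
    {ℓ : Fin L} {z : Fin p → ℝ} (hz : z ∈ Z ℓ) : f i z = φ i ℓ + Φ i ℓ *ᵥ z := by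
  rw [h.eq, Finset.sum_eq_single ℓ, Set.indicator_of_mem hz]
  · intro ℓ' _ hne
    exact Set.indicator_of_notMem (fun h' => Set.disjoint_left.1 (h.disjoint hne) h' hz) _
  · simp

/-- Increments of the functions of a piecewise affine VAR are, jointly, convex combinations of the
increments of its affine pieces. -/
theorem IsPiecewiseAffineVAR.sub_mem_convexHull (h : IsPiecewiseAffineVAR Z φ Φ f)
    (w w' : Fin p → ℝ) : (fun i => f i w - f i w')
      ∈ convexHull ℝ (Set.range fun ℓ i => Φ i ℓ *ᵥ (w - w')) := by
  have hγ : Continuous fun t : ℝ => w' + t • (w - w') := by fun_prop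
  -- The curve takes values in the product over `i`, so one set of weights serves all the functions;
  -- convexity of the cells makes their traces on the segment intervals.
  have key := sub_mem_convexHull_of_piecewise_affine (L := L)
    (F := fun (t : ℝ) (i : Fin (k + 1)) => f i (w' + t • (w - w')))
    (continuous_pi fun i => (h.continuous i).comp hγ)
    (fun ℓ => {t | w' + t • (w - w') ∈ Z ℓ})
    (fun ℓ => by
      refine Convex.ordConnected ?_
      intro s hs t ht a b ha hb hab
      have e : w' + (a • s + b • t) • (w - w')
          = a • (w' + s • (w - w')) + b • (w' + t • (w - w')) := by
        have h1 : w' = a • w' + b • w' := by rw [← add_smul, hab, one_smul]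
        nth_rewrite 1 [h1]
        simp only [smul_add, add_smul, smul_smul, smul_eq_mul]
        abel
      show w' + (a • s + b • t) • (w - w') ∈ Z ℓ
      rw [e]
      exact h.convex ℓ hs ht ha hb hab)
    (fun ℓ ℓ' hne => Set.disjoint_left.2 fun t h1 h2 => Set.disjoint_left.1 (h.disjoint hne) h1 h2)
    (fun t => h.exists_mem _)
    (fun ℓ i => φ i ℓ + Φ i ℓ *ᵥ w') (fun ℓ i => Φ i ℓ *ᵥ (w - w'))
    (fun ℓ t ht => by
      ext1 i
      rw [h.apply_of_mem i ht]
      simp only [Pi.add_apply, Pi.smul_apply, Matrix.mulVec_add, Matrix.mulVec_smul, add_assoc])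
  have e : (fun i => f i w - f i w')
      = (fun i => f i (w' + (1 : ℝ) • (w - w'))) - fun i => f i (w' + (0 : ℝ) • (w - w')) := by
    ext1 i
    simp
  rw [e]
  exact key

lemma IsPiecewiseAffineVAR.exists_norm_le (h : IsPiecewiseAffineVAR Z φ Φ f) (i : Fin (k + 1)) :
    ∃ C, 0 ≤ C ∧ ∀ z, ‖f i z‖ ≤ C * (1 + ‖z‖) := by
  let T : Fin L → (Fin p → ℝ) →L[ℝ] (Fin p → ℝ) := fun ℓ =>
    LinearMap.toContinuousLinearMap (Φ i ℓ).mulVecLin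
  refine ⟨∑ ℓ, (‖φ i ℓ‖ + ‖T ℓ‖), by positivity, fun z => ?_⟩
  obtain ⟨ℓ, hℓ⟩ := h.exists_mem z
  have h1 : ‖φ i ℓ‖ + ‖T ℓ‖ ≤ ∑ ℓ, (‖φ i ℓ‖ + ‖T ℓ‖) :=
    Finset.single_le_sum (f := fun ℓ => ‖φ i ℓ‖ + ‖T ℓ‖) (fun _ _ => by positivity)
      (Finset.mem_univ ℓ)
  have h2 : ‖Φ i ℓ *ᵥ z‖ ≤ ‖T ℓ‖ * ‖z‖ := (T ℓ).le_opNorm z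
  rw [h.apply_of_mem i hℓ]
  refine (norm_add_le _ _).trans (le_trans ?_ (mul_le_mul_of_nonneg_right h1 (by positivity)))
  nlinarith [norm_nonneg (φ i ℓ), norm_nonneg (T ℓ), norm_nonneg z]

lemma IsPiecewiseAffineVAR.integrable_smul (h : IsPiecewiseAffineVAR Z φ Φ f)
    {K : (Fin p → ℝ) → ℝ} (hK : Continuous K) (hK0 : ∀ u, 0 ≤ K u) (hKi : Integrable K)
    (hKint : Integrable fun u : Fin p → ℝ => K u • u) (i : Fin (k + 1)) (z : Fin p → ℝ) :
    Integrable fun u => K u • f i (z + u) := by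
  obtain ⟨C, hC0, hC⟩ := h.exists_norm_le i
  have hbound : Integrable fun u => C * (1 + ‖z‖) * K u + C * ‖K u • u‖ :=
    (hKi.const_mul _).add (hKint.norm.const_mul _)
  refine hbound.mono' (Continuous.aestronglyMeasurable ?_) (Filter.Eventually.of_forall fun u => ?_)
  · exact hK.smul ((h.continuous i).comp (by fun_prop))
  · rw [norm_smul, norm_smul, Real.norm_of_nonneg (hK0 u)]
    have h1 : ‖f i (z + u)‖ ≤ C * (1 + (‖z‖ + ‖u‖)) :=
      (hC _).trans (by gcongr; exact norm_add_le _ _)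
    calc K u * ‖f i (z + u)‖ ≤ K u * (C * (1 + (‖z‖ + ‖u‖))) :=
          mul_le_mul_of_nonneg_left h1 (hK0 u)
      _ = _ := by ring

end PiecewiseAffine

/-! ### Smoothing. -/

/-- The functions `g` have increments that are, jointly, convex combinations of the increments of
the linear maps `Φ · ℓ`. -/
def HasConvexIncrements (Φ : Fin (k + 1) → Fin L → Matrix (Fin p) (Fin p) ℝ)
    (g : Fin (k + 1) → (Fin p → ℝ) → (Fin p → ℝ)) : Prop :=
  ∀ w w' : Fin p → ℝ, (fun i => g i w - g i w')
    ∈ convexHull ℝ (Set.range fun ℓ i => Φ i ℓ *ᵥ (w - w'))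

/-- Translating both points by `u` leaves `w - w'`, hence the hull, unchanged; the smoothed
increment is an average of points of that one closed convex set. -/
theorem HasConvexIncrements.smoothed {Φ : Fin (k + 1) → Fin L → Matrix (Fin p) (Fin p) ℝ}
    {f : Fin (k + 1) → (Fin p → ℝ) → (Fin p → ℝ)} (h : HasConvexIncrements Φ f)
    {K : (Fin p → ℝ) → ℝ} (hK : Continuous K) (hK0 : ∀ u, 0 ≤ K u) (hK1 : ∫ u, K u = 1)
    (hint : ∀ i z, Integrable fun u => K u • f i (z + u)) :
    HasConvexIncrements Φ fun i => smoothed K (f i) := by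
  intro w w'
  have hi : ∀ i, Integrable fun u => K u • (f i (w + u) - f i (w' + u)) := fun i => by
    simp only [smul_sub]
    exact (hint i w).sub (hint i w')
  have hi' : Integrable fun u => K u • fun i => f i (w + u) - f i (w' + u) :=
    Integrable.of_eval hi
  have e : (fun i => NVAR.smoothed K (f i) w - NVAR.smoothed K (f i) w')
      = ∫ u, K u • fun i => f i (w + u) - f i (w' + u) := by
    ext1 i
    have h1 := (ContinuousLinearMap.proj (R := ℝ) (φ := fun _ : Fin (k + 1) => Fin p → ℝ)
      i).integral_comp_comm hi'
    simp only [ContinuousLinearMap.proj_apply, Pi.smul_apply] at h1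
    rw [← h1]
    simp only [smul_sub]
    rw [integral_sub (hint i w) (hint i w')]
    rfl
  rw [e]
  refine integral_density_smul_mem hK.measurable hK0 hK1 (convex_convexHull ℝ _)
    ((Set.finite_range _).isClosed_convexHull ℝ) (fun u => ?_) hi'
  have := h (w + u) (w' + u)
  rwa [add_sub_add_right_eq_sub] at this

lemma piMap_smoothed {f : Fin (k + 1) → (Fin p → ℝ) → (Fin p → ℝ)} {K : (Fin p → ℝ) → ℝ}
    (hint : ∀ i z, Integrable fun u => K u • f i (z + u)) (z : Fin p → ℝ) :
    (Integrable fun u => K u • piMap f (z + u)) ∧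
      piMap (fun i => smoothed K (f i)) z = ∫ u, K u • piMap f (z + u) := by
  have hsum : Integrable fun u => ∑ i : Fin k, K u • f i.succ (z + u) :=
    integrable_finsetSum _ fun i _ => hint i.succ z
  have e : (fun u => K u • piMap f (z + u))
      = fun u => -(K u • f 0 (z + u)) + ∑ i : Fin k, K u • f i.succ (z + u) := by
    ext1 u
    rw [piMap, smul_add, smul_neg, Finset.smul_sum]
  have hneg : Integrable fun u => -(K u • f 0 (z + u)) := (hint 0 z).neg
  rw [e]
  refine ⟨hneg.add hsum, ?_⟩
  rw [integral_add hneg hsum, integral_neg,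
    integral_finsetSum _ fun i _ => hint i.succ z]
  rfl

/-- If `π` takes its values in the column space of `α`, so does its smoothed version. -/
theorem exists_piMap_smoothed_eq {α : Matrix (Fin p) (Fin r) ℝ}
    {f : Fin (k + 1) → (Fin p → ℝ) → (Fin p → ℝ)} (hf : ∀ z, ∃ x, piMap f z = α *ᵥ x)
    {K : (Fin p → ℝ) → ℝ} (hK : Continuous K) (hK0 : ∀ u, 0 ≤ K u) (hK1 : ∫ u, K u = 1)
    (hint : ∀ i z, Integrable fun u => K u • f i (z + u)) (z : Fin p → ℝ) :
    ∃ x, piMap (fun i => smoothed K (f i)) z = α *ᵥ x := by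
  obtain ⟨h1, h2⟩ := piMap_smoothed hint z
  set V := LinearMap.range α.mulVecLin with hV
  have hmem : ∫ u, K u • piMap f (z + u) ∈ (V : Set (Fin p → ℝ)) := by
    refine integral_density_smul_mem hK.measurable hK0 hK1 V.convex V.closed_of_finiteDimensional
      (fun u => ?_) h1
    obtain ⟨x, hx⟩ := hf (z + u)
    exact ⟨x, hx.symm⟩
  obtain ⟨x, hx⟩ := hmem
  exact ⟨x, h2.trans hx.symm⟩

theorem IsPiecewiseAffineVAR.exists_piMap_eq {Z : Fin L → Set (Fin p → ℝ)}
    {φ : Fin (k + 1) → Fin L → (Fin p → ℝ)} {Φ : Fin (k + 1) → Fin L → Matrix (Fin p) (Fin p) ℝ}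
    {f : Fin (k + 1) → (Fin p → ℝ) → (Fin p → ℝ)} (h : IsPiecewiseAffineVAR Z φ Φ f)
    {α : Matrix (Fin p) (Fin r) ℝ} {μbar : Fin L → (Fin r → ℝ)}
    (hπbar : ∀ ℓ, -(φ 0 ℓ - ∑ i : Fin k, φ i.succ ℓ) = α *ᵥ μbar ℓ)
    {β : Fin L → Matrix (Fin p) (Fin r) ℝ}
    (hPi : ∀ ℓ, -(Φ 0 ℓ - ∑ i : Fin k, Φ i.succ ℓ) = α * (β ℓ)ᵀ) (z : Fin p → ℝ) :
    ∃ x, piMap f z = α *ᵥ x := by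
  obtain ⟨ℓ, hℓ⟩ := h.exists_mem z
  refine ⟨μbar ℓ + (β ℓ)ᵀ *ᵥ z, ?_⟩
  rw [Matrix.mulVec_add, Matrix.mulVec_mulVec, ← hπbar, ← hPi, piMap]
  simp only [h.apply_of_mem _ hℓ]
  rw [Matrix.neg_mulVec, Matrix.sub_mulVec, Matrix.sum_mulVec, Finset.sum_add_distrib]
  abel

/-! ### Membership in the class. -/

lemma opNorm_sum_smul_le {m n : Type*} [Fintype m] [Fintype n] [DecidableEq n] {ι : Type*}
    [Fintype ι] (M : ι → Matrix m n ℝ) (w : ι → ℝ) (hw : ∀ i, 0 ≤ w i) (hw1 : ∑ i, w i = 1)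
    {b : ℝ} (hb : ∀ i, opNorm (M i) ≤ b) : opNorm (∑ i, w i • M i) ≤ b := by
  rw [opNorm, map_sum, map_sum]
  refine (norm_sum_le _ _).trans ?_
  calc _ ≤ ∑ i, w i * b := by
        refine Finset.sum_le_sum fun i _ => ?_
        rw [map_smul, map_smul, norm_smul, Real.norm_of_nonneg (hw i)]
        exact mul_le_mul_of_nonneg_left (hb i) (hw i)
    _ = b := by rw [← Finset.sum_mul, hw1, one_mul]

/-- A joint spectral radius bound for the pieces carries over to the hull of their gradients. -/
theorem jsr_convexHull_boldBeta_le [Nonempty (Fin L)] (α : Matrix (Fin p) (Fin r) ℝ)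
    (b : Fin L → Matrix (StateIdx k p) (EqIdx k p r) ℝ) {ρ : ℝ} (hρ : 0 ≤ ρ)
    (h : jsr {M | ∃ ℓ, M = 1 + (b ℓ)ᵀ * boldAlpha k α} ≤ ENNReal.ofReal ρ) :
    jsr {M | ∃ β ∈ convexHull ℝ (Set.range b), M = 1 + βᵀ * boldAlpha k α}
      ≤ ENNReal.ofReal ρ := by
  have e : {M | ∃ ℓ, M = 1 + (b ℓ)ᵀ * boldAlpha k α}
      = Set.range fun ℓ => 1 + (b ℓ)ᵀ * boldAlpha k α := by
    ext M
    exact exists_congr fun ℓ => eq_comm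
  rw [e] at h
  -- The map `β ↦ 1 + βᵀ * boldAlpha k α` is affine, so it sends the hull of the gradients into the
  -- hull of the images.
  refine (jsr_mono ?_).trans (jsr_convexHull_range_le _ hρ h)
  rintro _ ⟨β, hβ, rfl⟩
  refine convexHull_min (t := {β | 1 + βᵀ * boldAlpha k α ∈ convexHull ℝ
    (Set.range fun ℓ => 1 + (b ℓ)ᵀ * boldAlpha k α)}) ?_ ?_ hβ
  · rintro _ ⟨ℓ, rfl⟩
    exact subset_convexHull ℝ _ ⟨ℓ, rfl⟩
  · intro x hx y hy s t hs ht hst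
    have e : 1 + (s • x + t • y)ᵀ * boldAlpha k α
        = s • (1 + xᵀ * boldAlpha k α) + t • (1 + yᵀ * boldAlpha k α) := by
      rw [Matrix.transpose_add, Matrix.transpose_smul, Matrix.transpose_smul, Matrix.add_mul,
        Matrix.smul_mul, Matrix.smul_mul, smul_add, smul_add, add_add_add_comm, ← add_smul, hst,
        one_smul]
    rw [Set.mem_ofPred_eq, e]
    exact convex_convexHull ℝ _ hx hy hs ht hst

lemma mulVec_injective_of_rank {α : Matrix (Fin p) (Fin r) ℝ} (hα : α.rank = r) :
    Function.Injective α.mulVec := by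
  have hker : Module.finrank ℝ (LinearMap.ker α.mulVecLin) = 0 := by
    have h1 := α.mulVecLin.finrank_range_add_finrank_ker
    rw [Matrix.rank] at hα
    simp only [Module.finrank_fin_fun] at h1
    omega
  rw [Submodule.finrank_eq_zero] at hker
  exact LinearMap.ker_eq_bot.1 hker

/-- Convex increments, a common invertible leading matrix, and the factorisation of `π` through `α`
give membership in the class, with the convex hull of the gradients of the pieces. -/
theorem memClassWith_of_hasConvexIncrements [Nonempty (Fin L)]
    {Φ : Fin (k + 1) → Fin L → Matrix (Fin p) (Fin p) ℝ} {c : Fin p → ℝ}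
    {g : Fin (k + 1) → (Fin p → ℝ) → (Fin p → ℝ)} {α : Matrix (Fin p) (Fin r) ℝ}
    (hα : α.rank = r) {ρbar : ℝ} (hρ : 0 ≤ ρbar) (hg : HasConvexIncrements Φ g)
    {μ : Fin r → ℝ} (hc : c = α *ᵥ μ) (hπ : ∀ z, ∃ x, piMap g z = α *ᵥ x)
    {β : Fin L → Matrix (Fin p) (Fin r) ℝ}
    (hPi : ∀ ℓ, -(Φ 0 ℓ - ∑ i : Fin k, Φ i.succ ℓ) = α * (β ℓ)ᵀ)
    (hjsr : jsr {M | ∃ ℓ, M = 1 + (boldBeta (fun i => Φ i ℓ) (β ℓ))ᵀ * boldAlpha k α}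
      ≤ ENNReal.ofReal ρbar)
    {Φ₀ : Matrix (Fin p) (Fin p) ℝ} (hΦ₀ : IsUnit Φ₀) (hcommon : ∀ ℓ, Φ 0 ℓ = Φ₀)
    {bbar : ℝ} (hb : ∀ ℓ, opNorm (boldBeta (fun i => Φ i ℓ) (β ℓ)) ≤ bbar) :
    MemClassWith α bbar ρbar c g
      (convexHull ℝ (Set.range fun ℓ => boldBeta (fun i => Φ i ℓ) (β ℓ))) := by
  have hinj := mulVec_injective_of_rank hα
  have hdet : IsUnit Φ₀.det := (Matrix.isUnit_iff_isUnit_det _).1 hΦ₀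
  have hweights : ∀ w w' : Fin p → ℝ, ∃ a : Fin L → ℝ, (∀ ℓ, 0 ≤ a ℓ) ∧ ∑ ℓ, a ℓ = 1 ∧
      ∀ i, g i w - g i w' = ∑ ℓ, a ℓ • (Φ i ℓ *ᵥ (w - w')) := fun w w' => by
    obtain ⟨a, ha, ha1, h⟩ := exists_weights_of_mem_convexHull_range (hg w w')
    refine ⟨a, ha, ha1, fun i => ?_⟩
    simpa using congrFun h i
  choose θ hθ using hπ
  -- With a common leading matrix, weights of sum one leave no choice for the increment of `g 0`.
  have hg0 : ∀ z, g 0 z = Φ₀ *ᵥ z + g 0 0 := fun z => by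
    obtain ⟨a, -, ha1, h⟩ := hweights z 0
    have h0 := h 0
    simp only [hcommon, ← Finset.sum_smul, ha1, one_smul, sub_zero] at h0
    rw [← h0, sub_add_cancel]
  let F₀ : (Fin p → ℝ) ≃ₜ (Fin p → ℝ) :=
    { toFun := fun z => Φ₀ *ᵥ z + g 0 0
      invFun := fun y => Φ₀⁻¹ *ᵥ (y - g 0 0)
      left_inv := fun z => by
        simp [Matrix.mulVec_mulVec, Matrix.nonsing_inv_mul _ hdet]
      right_inv := fun y => by
        simp [Matrix.mulVec_mulVec, Matrix.mul_nonsing_inv _ hdet]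
      continuous_toFun := by fun_prop
      continuous_invFun := by fun_prop }
  have hFsub : ∀ z z' : Fin p → ℝ, Φ₀⁻¹ *ᵥ (z - z') = F₀.symm z - F₀.symm z' := fun z z' => by
    show _ = Φ₀⁻¹ *ᵥ (z - g 0 0) - Φ₀⁻¹ *ᵥ (z' - g 0 0)
    rw [← Matrix.mulVec_sub, sub_sub_sub_cancel_right]
  refine ⟨F₀, μ, θ, fun z => (hg0 z).symm, hc, hθ, ((Set.finite_range _).isClosed_convexHull ℝ), ?_,
    jsr_convexHull_boldBeta_le α _ hρ hjsr, ?_⟩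
  · intro b hbmem
    obtain ⟨a, ha, ha1, rfl⟩ := exists_weights_of_mem_convexHull_range hbmem
    exact opNorm_sum_smul_le _ a ha ha1 hb
  · intro z z' ζ ζ'
    set w := F₀.symm z with hw
    set w' := F₀.symm z' with hw'
    obtain ⟨a, ha, ha1, h⟩ := hweights w w'
    -- `θ` was merely chosen pointwise; injectivity of `α` recovers its increments from those of
    -- `piMap g`.
    have hθsub : θ w - θ w' = ∑ ℓ, a ℓ • ((β ℓ)ᵀ *ᵥ (w - w')) := by
      apply hinj
      show α *ᵥ _ = α *ᵥ _
      have hsum : ∀ v : Fin L → Fin r → ℝ, α *ᵥ (∑ ℓ, a ℓ • v ℓ) = ∑ ℓ, a ℓ • (α *ᵥ v ℓ) :=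
        fun v => by
          have := map_sum α.mulVecLin (fun ℓ => a ℓ • v ℓ) Finset.univ
          simp only [Matrix.mulVecLin_apply, Matrix.mulVec_smul] at this
          exact this
      rw [Matrix.mulVec_sub, ← hθ, ← hθ, hsum]
      simp only [Matrix.mulVec_mulVec, ← hPi]
      have e : piMap g w - piMap g w'
          = -(g 0 w - g 0 w') + ∑ i : Fin k, (g i.succ w - g i.succ w') := by
        rw [piMap, piMap, Finset.sum_sub_distrib]
        abel
      rw [e]
      simp only [h, Matrix.neg_mulVec, Matrix.sub_mulVec, Matrix.sum_mulVec, smul_neg, smul_sub,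
        Finset.smul_sum, Finset.sum_neg_distrib, Finset.sum_sub_distrib]
      rw [Finset.sum_comm]
      abel
    -- The weights for the increment between `w` and `w'` also serve here: `Φ₀⁻¹` sends `z - z'` to
    -- `w - w'` for every `ℓ`, and the constant block `matD k p` is unaffected by averaging.
    refine ⟨∑ ℓ, a ℓ • boldBeta (fun i => Φ i ℓ) (β ℓ), ?_, ?_⟩
    · exact (convex_convexHull ℝ _).sum_mem (fun ℓ _ => ha ℓ) ha1
        fun ℓ _ => subset_convexHull ℝ _ ⟨ℓ, rfl⟩
    · have hstate : (Sum.elim z ζ - Sum.elim z' ζ' : StateIdx k p → ℝ)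
          = Sum.elim (z - z') (ζ - ζ') := by
        ext x
        cases x <;> rfl
      have hβ : ∀ ℓ, (boldBeta (fun i => Φ i ℓ) (β ℓ))ᵀ *ᵥ Sum.elim (z - z') (ζ - ζ')
          = Sum.elim ((β ℓ)ᵀ *ᵥ (w - w'))
            (boldGamma (fun i => Φ i ℓ) *ᵥ (w - w') + matD k p *ᵥ (ζ - ζ')) := fun ℓ => by
        rw [boldBeta, Matrix.transpose_transpose, Matrix.fromBlocks_mulVec, hcommon]
        simp only [Sum.elim_comp_inl, Sum.elim_comp_inr, Matrix.zero_mulVec, add_zero,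
          ← Matrix.mulVec_mulVec, hFsub]
        rfl
      have hD : ∀ (z : Fin p → ℝ) (ζ : Fin (k - 1) × Fin p → ℝ),
          boldD0 k p r *ᵥ Sum.elim z ζ = Sum.elim (0 : Fin r → ℝ) (matD k p *ᵥ ζ) := fun z ζ => by
        rw [boldD0, Matrix.fromBlocks_mulVec]
        simp
      rw [hstate, Matrix.transpose_sum, Matrix.sum_mulVec]
      simp only [Matrix.transpose_smul, Matrix.smul_mulVec, hβ, hD]
      ext x
      rcases x with x | x
      · have := congrFun hθsub x
        simpa [boldTheta] using this
      · have hΓ : ∀ ℓ, (boldGamma (fun i => Φ i ℓ) *ᵥ (w - w')) x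
            = -∑ i : Fin (k + 1) with x.1.val + 1 < i.val, (Φ i ℓ *ᵥ (w - w')) x.2 := fun ℓ => by
          have h1 : (boldGamma (fun i => Φ i ℓ) *ᵥ (w - w')) x
              = ((-∑ i : Fin (k + 1) with x.1.val + 1 < i.val, Φ i ℓ) *ᵥ (w - w')) x.2 := rfl
          rw [h1, Matrix.neg_mulVec, Matrix.sum_mulVec, Pi.neg_apply, Finset.sum_apply]
        have hgsub : gMap g (x.1.val + 1) w x.2 - gMap g (x.1.val + 1) w' x.2
            = ∑ ℓ, a ℓ * (boldGamma (fun i => Φ i ℓ) *ᵥ (w - w')) x := by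
          have e : gMap g (x.1.val + 1) w x.2 - gMap g (x.1.val + 1) w' x.2
              = -∑ i : Fin (k + 1) with x.1.val + 1 < i.val, (g i w - g i w') x.2 := by
            simp only [gMap, Pi.neg_apply, Finset.sum_apply, Pi.sub_apply, Finset.sum_sub_distrib]
            ring
          rw [e]
          simp only [h, hΓ, Finset.sum_apply, Pi.smul_apply, smul_eq_mul, mul_neg,
            Finset.sum_neg_distrib, Finset.mul_sum]
          rw [Finset.sum_comm]
        have hone : ∑ ℓ, a ℓ * (matD k p *ᵥ (ζ - ζ')) x = (matD k p *ᵥ (ζ - ζ')) x := by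
          rw [← Finset.sum_mul, ha1, one_mul]
        simp only [boldTheta, Pi.sub_apply, Pi.add_apply, Sum.elim_inr, Finset.sum_apply,
          Pi.smul_apply, smul_eq_mul, mul_add, Finset.sum_add_distrib]
        rw [hone, ← hgsub, Matrix.mulVec_sub, Pi.sub_apply]
        ring

end NVAR

end

theorem mainTheorem8 {k p r L : ℕ} (hk : 1 ≤ k)
    (Z : Fin L → Set (Fin p → ℝ))
    (φ : Fin (k + 1) → Fin L → (Fin p → ℝ))
    (Φ : Fin (k + 1) → Fin L → Matrix (Fin p) (Fin p) ℝ)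
    (c : Fin p → ℝ) (f : Fin (k + 1) → (Fin p → ℝ) → (Fin p → ℝ))
    (α : Matrix (Fin p) (Fin r) ℝ) (hα : α.rank = r)
    (ρbar : ℝ) (hρ0 : 0 ≤ ρbar) (hρ1 : ρbar < 1)
    (hmodel : NVAR.IsPiecewiseLinearVAR Z φ Φ f ∨ NVAR.IsThresholdAffineVAR Z φ Φ f)
    -- PWA.1
    (hdet : ∀ ℓ, (Φ 0 ℓ).det ≠ 0)
    (hsign : ∀ ℓ ℓ', SignType.sign (Φ 0 ℓ).det = SignType.sign (Φ 0 ℓ').det)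
    -- PWA.2
    (μ : Fin r → ℝ) (hc : c = α *ᵥ μ)
    (μbar : Fin L → (Fin r → ℝ))
    (hπbar : ∀ ℓ, -(φ 0 ℓ - ∑ i : Fin k, φ i.succ ℓ) = α *ᵥ μbar ℓ)
    (β : Fin L → Matrix (Fin p) (Fin r) ℝ) (hβ : ∀ ℓ, (β ℓ).rank = r)
    (hPi : ∀ ℓ, -(Φ 0 ℓ - ∑ i : Fin k, Φ i.succ ℓ) = α * (β ℓ)ᵀ)
    -- PWA.3
    (hjsr : NVAR.jsr {M | ∃ ℓ, M = 1 + (NVAR.boldBeta (fun i => Φ i ℓ) (β ℓ))ᵀ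
        * NVAR.boldAlpha k α} ≤ ENNReal.ofReal ρbar)
    -- the common nonsingular leading matrix
    (Φ₀ : Matrix (Fin p) (Fin p) ℝ) (hΦ₀ : IsUnit Φ₀) (hcommon : ∀ ℓ, Φ 0 ℓ = Φ₀)
    -- the kernel
    (K : (Fin p → ℝ) → ℝ) (hKcont : Continuous K) (hKnonneg : ∀ u, 0 ≤ K u)
    (hKmass : ∫ u, K u = 1)
    (hKint : MeasureTheory.Integrable (fun u : Fin p → ℝ => K u • u))
    (hKmean : ∫ u, K u • u = 0)
    (bbar : ℝ) (hb : ∀ ℓ, NVAR.opNorm (NVAR.boldBeta (fun i => Φ i ℓ) (β ℓ)) ≤ bbar)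
    (B : Set (Matrix (NVAR.StateIdx k p) (NVAR.EqIdx k p r) ℝ))
    (hB : B = convexHull ℝ (Set.range fun ℓ => NVAR.boldBeta (fun i => Φ i ℓ) (β ℓ))) :
    -- the smoothed functions are well defined
    (∀ i z, MeasureTheory.Integrable (fun u => K u • f i (z + u))) ∧
    -- the smoothed model is in the class
    NVAR.MemClass α bbar ρbar c (fun i => NVAR.smoothed K (f i)) ∧
    -- `B` is a set of gradients for both the original and the smoothed model
    NVAR.MemClassWith α bbar ρbar c f B ∧
    NVAR.MemClassWith α bbar ρbar c (fun i => NVAR.smoothed K (f i)) B := by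
  have haff : NVAR.IsPiecewiseAffineVAR Z φ Φ f := hmodel.elim
    NVAR.IsPiecewiseLinearVAR.toIsPiecewiseAffineVAR
    NVAR.IsThresholdAffineVAR.toIsPiecewiseAffineVAR
  have : Nonempty (Fin L) := ⟨(haff.exists_mem 0).choose⟩
  have hKi : MeasureTheory.Integrable K := by
    by_contra h
    rw [MeasureTheory.integral_undef h] at hKmass
    exact zero_ne_one hKmass
  have hint := haff.integrable_smul hKcont hKnonneg hKi hKint
  have hinc : NVAR.HasConvexIncrements Φ f := haff.sub_mem_convexHull
  have hπ := haff.exists_piMap_eq hπbar hPi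
  have hsmooth : NVAR.MemClassWith α bbar ρbar c (fun i => NVAR.smoothed K (f i)) B := hB ▸
    NVAR.memClassWith_of_hasConvexIncrements hα hρ0
      (hinc.smoothed hKcont hKnonneg hKmass hint) hc
      (NVAR.exists_piMap_smoothed_eq hπ hKcont hKnonneg hKmass hint) hPi hjsr hΦ₀ hcommon hb
  exact ⟨hint, ⟨B, hsmooth⟩, hB ▸
    NVAR.memClassWith_of_hasConvexIncrements hα hρ0 hinc hc hπ hPi hjsr hΦ₀ hcommon hb, hsmooth⟩
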